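/- A \emph{phase-polynomial form diagram} on $n$ ordered outputs (positions $1<\dots<n$) is a stabilizer ZX-diagram (a state, without inputs) with exactly one spider per output, such that red (X) spiders have phase $0$ or $\pi$, green (Z) spiders have phases in $\frac{\pi}{2}\mathbb{Z}$, no two red spiders are connected, spiders of different colours are connected by at most one plain edge, and any two green spiders by at most one Hadamard edge. Diagrams are considered up to nonzero scalars. By colour-changing the red spiders and unfusing the phases, such a diagram is regarded as a graph state diagram with single-qubit Clifford operators on its outputs (a GS-LC form diagram). On GS-LC form diagrams, local complementation about a vertex $u$ replaces the graph $G$ by $G\star u$ and merges $X_{-\pi/2}$ into the operator of $u$ and $Z_{\pi/2}$ into the operators of its neighbours; the pivot about an edge $uv$ replaces $G$ by $G\star u\star v\star u$ and merges a Hadamard gate into the operators of $u$ and of $v$ and $Z_\pi$ into those of their common neighbours. Let $|\psi\rangle=\sum_x\psi(x)|x\rangle$ be a stabilizer state with (affine) support $A=\{x\in\mathbb{Z}_2^n : \psi(x)\neq 0\}$. A set $F$ of indices is a set of free variables for $A$ if every assignment of values to the variables in $F$ extends to exactly one $x\in A$. The canonical set of free variables is obtained by going through $x_1,\dots,x_n$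 in ascending order and calling $x_j$ dependent if, for $x\in A$, its value is determined by the values of the free variables among $x_1,\dots,x_{j-1}$, and free otherwise. The \emph{canonical diagram} of $|\psi\rangle$ is the phase-polynomial form diagram whose green spiders are at the canonical free variables $F$, whose red spiders $k$ (with phase $a_k\pi$ and neighbourhood $N(k)\subseteq F$) express the dependent variables on $A$ as $x_k=a_k\oplus\bigoplus_{j\in N(k)}x_j$, and whose green phases $r_j\frac{\pi}{2}$ and Hadamard edges ($s_{jk}=1$ if $j,k$ are connected, $s_{jk}=0$ otherwise) satisfy $|\psi\rangle=\lambda\sum_{x\in A}i^{p(x)}|x\rangle$ with $p(x)=\sum_{j\in F}r_jx_j+2\sum_{j<k\in F}s_{jk}x_jx_k$ and some $\lambda\neq 0$. \textbf{Proposition.} Every phase-polynomial form diagram $D$ can be rewritten into canonical form, that is, into the canonical diagram of the state that $D$ represents, by a finite sequence of local complementations and pivots. Moreover, this is achieved by the following procedure. As long as some red spider $d$ is connected to a green spider $f$ with $d<f$, choose any such pair and swap its roles: if the phase of $f$ is $\pm\frac{\pi}{2}$, perform local complementations about $f$ and then about $d$, otherwise pivot about the edge $fd$; then push the remaining operators $X_\pi$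 at $f$ and $d$ through by the $\pi$-copy rule (two successive local complementations about the same vertex). Such a swap is always possible: it can be completed so as to give a phase-polynomial form diagram in which $f$ is red, $d$ is green, and all other colours are unchanged. The procedure terminates whatever pairs are chosen, each diagram that it reaches arises from $D$ by local complementations and pivots, and the diagram at which it stops is the canonical diagram of the state that $D$ represents. -/

import Mathlib

open Matrix
open scoped symmDiff

/-! Stabilizer ZX-diagrams of states (no inputs, `n` ordered outputs) and their interpretation. -/

/-- Green spiders are `Z`-spiders, red spiders are `X`-spiders. -/
inductive Colour where
  | green
  | red

/-- Components of the vectors `|+⟩` and `|-⟩` in the computational basis. -/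
noncomputable def ketPlus (_b : ZMod 2) : ℂ := 1 / (Real.sqrt 2 : ℂ)

noncomputable def ketMinus (b : ZMod 2) : ℂ := (-1) ^ b.val / (Real.sqrt 2 : ℂ)

/-- Entries of the Hadamard gate `|+⟩⟨0| + |-⟩⟨1|`. -/
noncomputable def hadamardEntry (a b : ZMod 2) : ℂ := if b = 0 then ketPlus a else ketMinus a

/-- The tensor of a spider with legs `L` and phase `k π / 2`, so that `e ^ (i k π / 2) = i ^ k`:
`|0…0⟩ + i ^ k |1…1⟩` for a green spider and `|+…+⟩ + i ^ k |-…-⟩` for a red one. -/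
noncomputable def spiderTensor (c : Colour) (k : ZMod 4) {L : Type} [Fintype L]
    (b : L → ZMod 2) : ℂ :=
  match c with
  | Colour.green =>
      (∏ l, if b l = 0 then (1 : ℂ) else 0) +
        Complex.I ^ k.val * ∏ l, if b l = 1 then (1 : ℂ) else 0
  | Colour.red => (∏ l, ketPlus (b l)) + Complex.I ^ k.val * ∏ l, ketMinus (b l)

/-- A stabilizer ZX-diagram without inputs: a finite set `V` of spiders with phases `k π / 2`, a
finite set `E` of wires between spiders, each of them plain or carrying a Hadamard node, and `n`
dangling output wires. -/
structure ZXDiagram (n : ℕ) where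
  V : Type
  E : Type
  fintypeV : Fintype V
  fintypeE : Fintype E
  colour : V → Colour
  phase : V → ZMod 4
  src : E → V
  tgt : E → V
  had : E → Bool
  out : Fin n → V

namespace ZXDiagram

variable {n : ℕ}

/-- The spider at the given end of a wire. -/
def endpoint (D : ZXDiagram n) (h : D.E × Bool) : D.V := if h.2 then D.tgt h.1 else D.src h.1

/-- The legs of a spider: the wire ends and the outputs incident with it. -/
abbrev Legs (D : ZXDiagram n) (v : D.V) : Type :=
  {h : D.E × Bool // D.endpoint h = v} ⊕ {j : Fin n // D.out j = v}

open Classical in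
/-- The linear map (here: the vector) of a ZX-diagram, in the computational basis: the contraction
of the tensors of the spiders along the wires. -/
noncomputable def interp (D : ZXDiagram n) (x : Fin n → ZMod 2) : ℂ :=
  letI := D.fintypeV
  letI := D.fintypeE
  ∑ w : D.E × Bool → ZMod 2,
    (∏ e : D.E,
      if D.had e then hadamardEntry (w (e, true)) (w (e, false))
      else if w (e, true) = w (e, false) then 1 else 0) *
    ∏ v : D.V, spiderTensor (D.colour v) (D.phase v)
      (Sum.elim (fun h => w h.1) (fun j => x j.1) : D.Legs v → ZMod 2)

end ZXDiagram

/-- A diagram in phase-polynomial form with `n` outputs. There is one spider for each output, all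
phases are multiples of `π / 2`, red spiders have phase `0` or `π`, and no two red spiders are
connected. Edges between spiders of different colours are plain, edges between green spiders carry
a Hadamard node, so the kind of an edge is determined by the colours of its ends. -/
structure PhasePolyDiagram (n : ℕ) where
  colour : Fin n → Colour
  phase : Fin n → ZMod 4
  graph : SimpleGraph (Fin n)
  red_phase : ∀ k, colour k = Colour.red → phase k = 0 ∨ phase k = 2
  red_indep : ∀ j k, colour j = Colour.red → colour k = Colour.red → ¬ graph.Adj j k

namespace PhasePolyDiagram

variable {n : ℕ}

open Classical in
/-- The ZX-diagram that a phase-polynomial form describes. -/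
noncomputable def toZX (D : PhasePolyDiagram n) : ZXDiagram n where
  V := Fin n
  E := {e : Fin n × Fin n // e.1 < e.2 ∧ D.graph.Adj e.1 e.2}
  fintypeV := inferInstance
  fintypeE := inferInstance
  colour := D.colour
  phase := D.phase
  src := fun e => e.1.1
  tgt := fun e => e.1.2
  had := fun e => decide (D.colour e.1.1 = Colour.green ∧ D.colour e.1.2 = Colour.green)
  out := id

/-- The vector of a diagram in phase-polynomial form. -/
noncomputable def interp (D : PhasePolyDiagram n) : (Fin n → ZMod 2) → ℂ := D.toZX.interp

end PhasePolyDiagram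

/-! Free variables and the canonical diagram of a state. -/

section Canonical

variable {n : ℕ}

/-- The computational basis states on which `ψ` is supported. -/
def supp (ψ : (Fin n → ZMod 2) → ℂ) : Set (Fin n → ZMod 2) := {x | ψ x ≠ 0}

/-- `F` is a set of free variables for `A`: every assignment of values to the variables in `F`
extends to exactly one element of `A`. -/
def IsFreeSet (A : Set (Fin n → ZMod 2)) (F : Set (Fin n)) : Prop :=
  ∀ v : Fin n → ZMod 2, ∃! x, x ∈ A ∧ ∀ j ∈ F, x j = v j

/-- The greedy choice of free variables, in ascending order: `x j` is dependent if for the elements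
`x` of `A` its value is fixed by the values of the free variables among those before it, and free
otherwise. -/
def IsCanonicalFree (A : Set (Fin n → ZMod 2)) (j : Fin n) : Prop :=
  ¬ ∀ x ∈ A, ∀ y ∈ A, (∀ k : Fin n, (_h : k < j) → IsCanonicalFree A k → x k = y k) → x j = y j
termination_by j

/-- The canonical set of free variables. -/
def canonicalFreeSet (A : Set (Fin n → ZMod 2)) : Set (Fin n) := {j | IsCanonicalFree A j}

open Classical in
/-- The phase polynomial `∑ j, r j * x j + 2 * ∑ j < k, s j k * x j * x k` modulo `4`, over the
green spiders `j`, `k` of a diagram, where `r j * π / 2` is the phase of `j` and `s j k = 1` if `j`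
and `k` are connected (by a Hadamard edge) and `s j k = 0` otherwise. -/
noncomputable def PhasePolyDiagram.phasePoly (C : PhasePolyDiagram n) (x : Fin n → ZMod 2) :
    ZMod 4 :=
  (∑ j with C.colour j = Colour.green, C.phase j * ((x j).val : ZMod 4)) +
    2 * ∑ e : Fin n × Fin n with e.1 < e.2 ∧ C.graph.Adj e.1 e.2 ∧
      C.colour e.1 = Colour.green ∧ C.colour e.2 = Colour.green,
      ((x e.1).val : ZMod 4) * ((x e.2).val : ZMod 4)

open Classical in
/-- `C` is the diagram translated from the pair of a state `ψ` and a set `F` of free variables for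
the support `A` of `ψ`: its green spiders are those in `F`; its red spiders `k`, with phase `a π`,
give the equations `x k = a ⊕ ⨁ x j`, with `j` running over the (green) neighbours of `k`, that
express the dependent variables on `A` through the free ones; and up to a nonzero scalar, `ψ` is
the sum of `i ^ p(x) |x⟩` over `x ∈ A`, where `p` is the phase polynomial of `C`. -/
def IsTranslation (ψ : (Fin n → ZMod 2) → ℂ) (F : Set (Fin n)) (C : PhasePolyDiagram n) : Prop :=
  IsFreeSet (supp ψ) F ∧
  (∀ j, C.colour j = Colour.green ↔ j ∈ F) ∧
  (∀ x ∈ supp ψ, ∀ k, C.colour k = Colour.red →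
    x k = (if C.phase k = 0 then 0 else 1) + ∑ j with C.graph.Adj k j, x j) ∧
  ∃ c : ℂ, c ≠ 0 ∧ ∀ x ∈ supp ψ, ψ x = c * Complex.I ^ (C.phasePoly x).val

/-- `C` is the canonical diagram of the state `ψ`. -/
def IsCanonicalDiagram (ψ : (Fin n → ZMod 2) → ℂ) (C : PhasePolyDiagram n) : Prop :=
  IsTranslation ψ (canonicalFreeSet (supp ψ)) C

end Canonical

/-! Single-qubit Clifford operators, up to nonzero scalars. -/

/-- Invertible linear operators on a single qubit, up to nonzero scalars. -/
abbrev PGL2 : Type := ProjGenLinGroup (Fin 2) ℂ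

/-- The Hadamard gate (its normalisation does not matter up to scalars) as a projective operator. -/
noncomputable def projH : PGL2 :=
  ProjGenLinGroup.mk
    (GeneralLinearGroup.mkOfDetNeZero !![(1 : ℂ), 1; 1, -1] (by norm_num [Matrix.det_fin_two]))

/-- The phase gate `Z_{π/2}` as a projective operator. -/
noncomputable def projS : PGL2 :=
  ProjGenLinGroup.mk
    (GeneralLinearGroup.mkOfDetNeZero !![(1 : ℂ), 0; 0, Complex.I] (by simp [Matrix.det_fin_two]))

/-- The single-qubit Clifford group modulo scalars. -/
noncomputable def cliffordGroup : Subgroup PGL2 := Subgroup.closure {projH, projS}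

/-- The Hadamard gate. -/
noncomputable def cliffH : cliffordGroup := ⟨projH, Subgroup.subset_closure (by simp)⟩

/-- The rotation `Z_{kπ/2}`, for an integer `k`. -/
noncomputable def cliffZ (k : ℤ) : cliffordGroup :=
  (⟨projS, Subgroup.subset_closure (by simp)⟩ : cliffordGroup) ^ k

/-- The rotation `X_{kπ/2} = H Z_{kπ/2} H`. -/
noncomputable def cliffX (k : ℤ) : cliffordGroup := cliffH * cliffZ k * cliffH

/-! Graph states with local Cliffords, local complementation and pivoting. -/

section Graph

variable {W : Type*}

/-- The local complementation of a graph about `u`: the edges between neighbours of `u` are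
toggled. -/
def localCompl (G : SimpleGraph W) (u : W) : SimpleGraph W :=
  G ∆ SimpleGraph.fromRel (fun b c => G.Adj b u ∧ G.Adj c u)

/-- The pivot of a graph about the edge `u v`. -/
def pivotGraph (G : SimpleGraph W) (u v : W) : SimpleGraph W :=
  localCompl (localCompl (localCompl G u) v) u

end Graph

/-- A GS-LC form diagram: a graph state diagram (a phase-free green spider with an output for each
vertex, a Hadamard edge for each edge of the graph) and, for each vertex, a single-qubit Clifford
operator (up to scalars) on its output wire. -/
structure GSLC (n : ℕ) where
  graph : SimpleGraph (Fin n)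
  vop : Fin n → cliffordGroup

namespace GSLC

variable {n : ℕ}

open Classical in
/-- Local complementation about `u`: it acts on the graph, and `X_{-π/2}` and `Z_{π/2}` are merged
(next to the graph state, so before the operators that are present) into the operators of `u` and
of its neighbours, respectively. -/
noncomputable def localComp (g : GSLC n) (u : Fin n) : GSLC n where
  graph := localCompl g.graph u
  vop := fun w =>
    if w = u then g.vop w * cliffX (-1)
    else if g.graph.Adj u w then g.vop w * cliffZ 1
    else g.vop w

open Classical in
/-- Pivot about the edge `u v`: it acts on the graph, and Hadamard gates are merged into the
operators of `u` and `v`, and `Z_π` into those of their common neighbours. -/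
noncomputable def pivot (g : GSLC n) (u v : Fin n) : GSLC n where
  graph := pivotGraph g.graph u v
  vop := fun w =>
    if w = u ∨ w = v then g.vop w * cliffH
    else if g.graph.Adj u w ∧ g.graph.Adj v w then g.vop w * cliffZ 2
    else g.vop w

/-- A single rewrite: a local complementation about some vertex or a pivot about some edge. -/
def Step (g g' : GSLC n) : Prop :=
  (∃ u, g' = g.localComp u) ∨ (∃ u v, g.graph.Adj u v ∧ g' = g.pivot u v)

/-- Rewriting by finitely many local complementations and pivots. -/
def Rewrites (g g' : GSLC n) : Prop := Relation.ReflTransGen Step g g'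

/-- The `π`-copy rule about `u`, that is, two local complementations about `u`. It pushes an
operator `X_π` next to the graph state through the spider `u`. -/
noncomputable def piCopy (g : GSLC n) (u : Fin n) : GSLC n := (g.localComp u).localComp u

end GSLC

namespace PhasePolyDiagram

variable {n : ℕ}

/-- The GS-LC form of a diagram in phase-polynomial form: red spiders are colour-changed, which
turns the plain edges into Hadamard edges and leaves a Hadamard gate on the output, and the phases
are unfused onto the outputs (inside of the Hadamard gate). -/
noncomputable def toGSLC (D : PhasePolyDiagram n) : GSLC n where
  graph := D.graph
  vop := fun j =>
    match D.colour j with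
    | Colour.green => cliffZ (D.phase j).val
    | Colour.red => cliffH * cliffZ (D.phase j).val

/-- `d` is a red spider, connected to the green spider `f` that appears later in the order. -/
def LaterConnection (D : PhasePolyDiagram n) (d f : Fin n) : Prop :=
  D.colour d = Colour.red ∧ D.colour f = Colour.green ∧ D.graph.Adj d f ∧ d < f

/-- The local complementations about `f` and then `d` if the phase of `f` is `± π / 2`, and the
pivot about the edge `f d` otherwise. -/
noncomputable def exchange (D : PhasePolyDiagram n) (d f : Fin n) : GSLC n :=
  open Classical in
  if D.phase f = 1 ∨ D.phase f = 3 then (D.toGSLC.localComp f).localComp d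
  else D.toGSLC.pivot f d

/-- `D'` arises from `D` by swapping the roles of the red spider `d` and the green spider `f`:
the two local complementations or the pivot, followed by applications of the `π`-copy rule about
`f` and `d` that move the remaining `X_π` operators, give a diagram in phase-polynomial form in
which `f` is red, `d` is green and all other colours are as before. -/
def SwapAt (d f : Fin n) (D D' : PhasePolyDiagram n) : Prop :=
  Relation.ReflTransGen (fun g g' : GSLC n => g' = g.piCopy f ∨ g' = g.piCopy d)
    (D.exchange d f) D'.toGSLC ∧
  D'.colour f = Colour.red ∧ D'.colour d = Colour.green ∧
  ∀ j, j ≠ d → j ≠ f → D'.colour j = D.colour j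

/-- A step of the procedure: a red spider and a later green spider connected to it are swapped. -/
def SwapStep (D D' : PhasePolyDiagram n) : Prop :=
  ∃ d f, D.LaterConnection d f ∧ SwapAt d f D D'

end PhasePolyDiagram

/-!
Up to scalars, the vector of a diagram in phase-polynomial form is a sum over an affine space: the
red spiders impose the equations `x k = a k + ∑ x j` over their (green) neighbours, the green
spiders are free, and the green phases and Hadamard edges contribute `i ^ p(x)`
(`PhasePolyDiagram.exists_interp_eq` and `PhasePolyDiagram.formVec_eq`). So every diagram is the
translation of its own state for the set of its green spiders, and only has to be shown that these
become the canonical free variables. They are canonical as soon as every red spider is connected to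
earlier green spiders only, for then the equations determine each dependent variable from the
earlier free ones (`PhasePolyDiagram.isCanonicalFree_iff`). This is exactly the situation in which
no swap applies.

It remains to see that swaps exist, terminate and preserve the state. After the two local
complementations or the pivot, the operators are those of a diagram in phase-polynomial form with
`f` red and `d` green, up to factors `X_π` at `f` and `d`; this rests on the Euler decomposition of
the Hadamard gate, which identifies the products of quarter turns that arise. The `π`-copy rule
removes the remaining factors (`PhasePolyDiagram.exists_swapAt`). Since `d < f`, a swap lowers the
sum of the positions of the green spiders, which gives termination.

A pivot is a composite of local complementations (`GSLC.pivot_eq`), so only local complementation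
has to be shown sound (`graphStateVec_localCompl`). If `m` neighbours of `u` have the value `1`, the
local complementation about `u` changes the number of edges with value `1` at both ends by
`m (m - 1) / 2` modulo `2`, and hence the phase by `i ^ (m ^ 2 - m)`. The gates `Z_{π/2}` contribute
`i ^ m`, and summing `i ^ (m ^ 2)` against `X_{-π/2}` at `u` gives back the phase of the original
graph state. As the operators of a GS-LC form diagram are given up to scalars only, the comparison
of states uses chosen matrix representatives, on which the state depends only by a scalar
(`GSLC.Represents.eq_smul`).
-/

/-! ### Local complementation and pivoting on graphs -/

section Graph

variable {W : Type*}

theorem localCompl_adj (G : SimpleGraph W) (u a b : W) :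
    (localCompl G u).Adj a b ↔
      (G.Adj a b ∧ ¬ (G.Adj u a ∧ G.Adj u b)) ∨
        (a ≠ b ∧ (G.Adj u a ∧ G.Adj u b) ∧ ¬ G.Adj a b) := by
  have h := G.ne_of_adj (a := a) (b := b)
  simp only [localCompl, symmDiff_def, SimpleGraph.sup_adj, SimpleGraph.sdiff_adj,
    SimpleGraph.fromRel_adj, G.adj_comm _ u, ne_eq]
  tauto

theorem localCompl_adj_left (G : SimpleGraph W) (u a : W) :
    (localCompl G u).Adj u a ↔ G.Adj u a := by
  simp [localCompl_adj]

theorem localCompl_localCompl (G : SimpleGraph W) (u : W) :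
    localCompl (localCompl G u) u = G := by
  ext a b
  have h := G.ne_of_adj (a := a) (b := b)
  simp only [localCompl_adj _ u a b, localCompl_adj_left]
  tauto

end Graph

/-! ### Relations between single-qubit Clifford operators -/

theorem projGL_mk_eq_of_smul {A B : GL (Fin 2) ℂ} {c : ℂ} (hc : c ≠ 0)
    (h : ∀ i j, A i j = c * B i j) : ProjGenLinGroup.mk A = ProjGenLinGroup.mk B := by
  refine (ProjGenLinGroup.mk_eq_mk_iff.2 ⟨Units.mk0 c hc, ?_⟩).symm
  ext i j
  simp [Matrix.scalar_apply, h, mul_comm]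

theorem projH_mul_self : projH * projH = 1 := by
  rw [projH, ← map_mul, ← map_one ProjGenLinGroup.mk]
  refine projGL_mk_eq_of_smul two_ne_zero fun i j => ?_
  fin_cases i <;> fin_cases j <;> simp [Matrix.mul_apply] <;> norm_num

theorem projS_pow_four : projS ^ 4 = 1 := by
  rw [projS, ← map_pow, ← map_one ProjGenLinGroup.mk]
  congr 1
  ext i j
  fin_cases i <;> fin_cases j <;>
    simp [pow_succ, Matrix.mul_apply, Complex.I_mul_I]

/-- The Euler decomposition of the Hadamard gate. -/
theorem projS_conj_projH : projS * (projH * projS * projH) * projS = projH := by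
  rw [projH, projS, ← map_mul, ← map_mul, ← map_mul, ← map_mul]
  have h0 : (1 + Complex.I) ≠ 0 := fun h => by simpa using congrArg Complex.re h
  refine projGL_mk_eq_of_smul h0 fun i j => ?_
  have hI := Complex.I_sq
  fin_cases i <;> fin_cases j <;> simp [Matrix.mul_apply] <;> grind

theorem cliffZ_add (a b : ℤ) : cliffZ (a + b) = cliffZ a * cliffZ b := zpow_add _ a b

theorem cliffZ_zero : cliffZ 0 = 1 := zpow_zero _

theorem cliffZ_four : cliffZ 4 = 1 := by
  apply Subtype.ext
  exact projS_pow_four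

theorem cliffZ_four_mul (k : ℤ) : cliffZ (4 * k) = 1 := by
  have h : cliffZ (4 * k) = cliffZ 4 ^ k := zpow_mul _ 4 k
  rw [h, cliffZ_four, _root_.one_zpow]

theorem cliffZ_eq_of_cast_eq {a b : ℤ} (h : (a : ZMod 4) = b) : cliffZ a = cliffZ b := by
  obtain ⟨k, hk⟩ := (ZMod.intCast_eq_intCast_iff_dvd_sub a b 4).1 h
  obtain rfl : b = a + 4 * k := by push_cast at hk; omega
  rw [cliffZ_add, cliffZ_four_mul, mul_one]

theorem cliffH_mul_self : cliffH * cliffH = 1 := Subtype.ext projH_mul_self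

theorem cliffH_mul_self_assoc (a : cliffordGroup) : cliffH * (cliffH * a) = a := by
  rw [← mul_assoc, cliffH_mul_self, one_mul]

theorem cliffZ_mul_cliffX_mul_cliffZ : cliffZ 1 * cliffX 1 * cliffZ 1 = cliffH := by
  have h : cliffZ 1 = ⟨projS, Subgroup.subset_closure (by simp)⟩ := zpow_one _
  rw [cliffX, h]
  exact Subtype.ext projS_conj_projH

/-- The inverse of the Euler decomposition: the Hadamard gate is its own inverse, so the signs of all
the quarter turns can be reversed. -/
theorem cliffX_neg_one : cliffX (-1) = cliffZ 1 * cliffH * cliffZ 1 := by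
  have h := cliffZ_mul_cliffX_mul_cliffZ
  have hz : cliffZ (-1) = (cliffZ 1)⁻¹ := by
    rw [eq_inv_iff_mul_eq_one, ← cliffZ_add]; exact cliffZ_zero
  have hi : cliffH⁻¹ = cliffH := inv_eq_of_mul_eq_one_left cliffH_mul_self
  have h2 : cliffX 1 = (cliffZ 1)⁻¹ * cliffH * (cliffZ 1)⁻¹ := by rw [← h]; group
  calc cliffX (-1) = (cliffX 1)⁻¹ := by
        simp only [cliffX, hz, _root_.mul_inv_rev, hi, mul_assoc]
    _ = _ := by rw [h2]; simp only [_root_.mul_inv_rev, inv_inv, hi, mul_assoc]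

theorem cliffX_two : cliffX 2 = cliffX (-1) * cliffX (-1) := by
  have h : cliffZ (-1 + -1) = cliffZ 2 := cliffZ_eq_of_cast_eq (by decide)
  simp only [cliffX, mul_assoc, cliffH_mul_self_assoc]
  rw [← mul_assoc (cliffZ (-1)), ← cliffZ_add, h]

theorem cliffX_two_mul_self : cliffX 2 * cliffX 2 = 1 := by
  simp only [cliffX, mul_assoc, cliffH_mul_self_assoc]
  rw [← mul_assoc (cliffZ 2), ← cliffZ_add]
  simp [cliffZ_four, cliffH_mul_self]

theorem cliffH_cliffZ_one_cliffH :
    cliffH * cliffZ 1 * cliffH = cliffZ (-1) * cliffH * cliffZ (-1) := by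
  have h := cliffZ_mul_cliffX_mul_cliffZ
  have hz : cliffZ (-1) = (cliffZ 1)⁻¹ := by
    rw [eq_inv_iff_mul_eq_one, ← cliffZ_add]; exact cliffZ_zero
  rw [hz]
  nth_rewrite 3 [← h]
  simp only [cliffX]
  group

/-- Obtained by squaring the relation `cliffH_cliffZ_one_cliffH`. -/
theorem cliffX_two_eq : cliffX 2 = cliffZ (-1) * cliffX 2 * cliffZ (-1) := by
  have h := cliffH_cliffZ_one_cliffH
  have h2 : cliffX 2 = (cliffH * cliffZ 1 * cliffH) * (cliffH * cliffZ 1 * cliffH) := by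
    simp only [cliffX, mul_assoc, cliffH_mul_self_assoc]
    rw [← mul_assoc (cliffZ 1), ← cliffZ_add]; rfl
  have h3 : cliffZ (-1) * cliffZ (-1) = cliffZ 2 := by
    rw [← cliffZ_add]; exact cliffZ_eq_of_cast_eq (by decide)
  nth_rewrite 1 [h2]
  rw [h]
  simp only [cliffX, mul_assoc]
  rw [← mul_assoc (cliffZ (-1)) (cliffZ (-1)), h3]

theorem cliffZ_one_mul_cliffX_two : cliffZ 1 * cliffX 2 = cliffX 2 * cliffZ (-1) := by
  nth_rewrite 1 [cliffX_two_eq]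
  rw [← mul_assoc, ← mul_assoc, ← cliffZ_add, add_neg_cancel, cliffZ_zero, one_mul]

theorem cliffZ_two_mul_cliffX_two : cliffZ 2 * cliffX 2 = cliffX 2 * cliffZ 2 := by
  have h : cliffZ 2 = cliffZ 1 * cliffZ 1 := by rw [← cliffZ_add]; rfl
  nth_rewrite 1 [h]
  rw [mul_assoc, cliffZ_one_mul_cliffX_two, ← mul_assoc, cliffZ_one_mul_cliffX_two, mul_assoc,
    ← cliffZ_add]
  congr 1
  exact cliffZ_eq_of_cast_eq (by decide)

theorem cliffH_mul_cliffX_two : cliffH * cliffX 2 = cliffZ 2 * cliffH := by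
  simp only [cliffX, mul_assoc, cliffH_mul_self_assoc]

/-! ### Rewriting of GS-LC form diagrams -/

namespace GSLC

variable {n : ℕ}

theorem ext {g g' : GSLC n} (hg : g.graph = g'.graph) (hv : ∀ w, g.vop w = g'.vop w) :
    g = g' := by
  cases g; cases g'
  obtain rfl := hg
  obtain rfl : _ = _ := funext hv
  rfl

open Classical in
theorem localComp_vop (g : GSLC n) (u w : Fin n) : (g.localComp u).vop w =
    if w = u then g.vop w * cliffX (-1)
    else if g.graph.Adj u w then g.vop w * cliffZ 1
    else g.vop w := rfl

theorem localComp_vop_self (g : GSLC n) (u : Fin n) :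
    (g.localComp u).vop u = g.vop u * cliffX (-1) := if_pos rfl

theorem localComp_vop_of_adj (g : GSLC n) {u w : Fin n} (h : g.graph.Adj u w) :
    (g.localComp u).vop w = g.vop w * cliffZ 1 := by
  rw [localComp_vop, if_neg (g.graph.ne_of_adj h).symm, if_pos h]

theorem localComp_vop_of_not_adj (g : GSLC n) {u w : Fin n} (hw : w ≠ u)
    (h : ¬ g.graph.Adj u w) : (g.localComp u).vop w = g.vop w := by
  rw [localComp_vop, if_neg hw, if_neg h]

theorem localComp_graph (g : GSLC n) (u : Fin n) :
    (g.localComp u).graph = localCompl g.graph u := rfl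

theorem piCopy_graph (g : GSLC n) (u : Fin n) : (g.piCopy u).graph = g.graph :=
  localCompl_localCompl _ _

open Classical in
theorem piCopy_vop (g : GSLC n) (u w : Fin n) : (g.piCopy u).vop w =
    if w = u then g.vop w * cliffX 2
    else if g.graph.Adj u w then g.vop w * cliffZ 2
    else g.vop w := by
  simp only [piCopy, localComp_vop, localComp_graph, localCompl_adj_left]
  have h : cliffZ 2 = cliffZ 1 * cliffZ 1 := by rw [← cliffZ_add]; rfl
  split_ifs
  · rw [cliffX_two, mul_assoc]
  · rw [h, mul_assoc]
  · rfl

/-- A pivot is a composite of local complementations: `u`, `v`, `u` produce the graph and, up to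
Pauli operators that two applications of the `π`-copy rule remove, the operators. -/
theorem pivot_eq (g : GSLC n) {u v : Fin n} (h : g.graph.Adj u v) :
    g.pivot u v = ((((g.localComp u).localComp v).localComp u).piCopy u).piCopy v := by
  have hne := g.graph.ne_of_adj h
  have hvu := h.symm
  have e2 : cliffZ 1 * cliffZ 1 = cliffZ 2 := by rw [← cliffZ_add]; rfl
  have e4 : cliffZ 2 * cliffZ 2 = 1 := by rw [← cliffZ_add]; exact cliffZ_four
  have hZXZ : cliffZ 1 * cliffX (-1) * cliffZ 1 = cliffZ 2 * cliffH * cliffZ 2 := by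
    rw [cliffX_neg_one, ← e2]; simp only [mul_assoc]
  -- The operators that are collected at `u` and at `v`.
  have hu : cliffX (-1) * cliffZ 1 * cliffX (-1) * cliffX 2 * cliffZ 2 = cliffH := by
    have h3 : cliffZ 1 * (cliffZ 1 * cliffZ 1) = cliffZ (-1) := by
      rw [← cliffZ_add, ← cliffZ_add]; exact cliffZ_eq_of_cast_eq (by decide)
    calc _ = cliffZ 1 * (cliffH * (cliffZ 1 * (cliffZ 1 * cliffZ 1)) * cliffH) * cliffZ 1
            * cliffX 2 * cliffZ 2 := by
          rw [cliffX_neg_one]; simp only [mul_assoc]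
      _ = cliffZ 1 * cliffX (-1) * cliffZ 1 * cliffX 2 * cliffZ 2 := by rw [h3]; rfl
      _ = (cliffH * cliffX 2) * (cliffZ 2 * cliffX 2) * cliffZ 2 := by
          rw [hZXZ, cliffH_mul_cliffX_two]; simp only [mul_assoc]
      _ = cliffH * (cliffX 2 * cliffX 2) * (cliffZ 2 * cliffZ 2) := by
          rw [cliffZ_two_mul_cliffX_two]; simp only [mul_assoc]
      _ = cliffH := by rw [e4, cliffX_two_mul_self, mul_one, mul_one]
  have hv : cliffZ 1 * cliffX (-1) * cliffZ 1 * cliffZ 2 * cliffX 2 = cliffH := by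
    rw [hZXZ, mul_assoc (_ * _) (cliffZ 2) (cliffZ 2), e4, mul_one, mul_assoc,
      cliffH_mul_cliffX_two, ← mul_assoc, e4, one_mul]
  refine GSLC.ext ?_ fun w => ?_
  · rw [piCopy_graph, piCopy_graph]; rfl
  · rw [piCopy_vop, piCopy_vop, piCopy_graph]
    simp only [pivot, localComp_vop, localComp_graph, localCompl_adj_left]
    by_cases hwu : w = u
    · subst hwu
      simp [hne, hne.symm, localCompl_adj, h, hvu, ← hu, mul_assoc]
    by_cases hwv : w = v
    · subst hwv
      simp [hne, hne.symm, localCompl_adj, h, hvu, ← hv, mul_assoc]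
    have hwu' : u ≠ w := Ne.symm hwu
    have hwv' : v ≠ w := Ne.symm hwv
    by_cases h1 : g.graph.Adj u w <;> by_cases h2 : g.graph.Adj v w <;>
      simp [hwu, hwv, hwu', hwv', hne.symm, localCompl_adj, h, hvu, h1, h2, mul_assoc, e2, e4]

/-- A single local complementation. -/
def LCStep (g g' : GSLC n) : Prop := ∃ u, g' = g.localComp u

theorem LCStep.piCopy (g : GSLC n) (u : Fin n) :
    Relation.ReflTransGen LCStep g (g.piCopy u) :=
  (Relation.ReflTransGen.single ⟨u, rfl⟩).tail ⟨u, rfl⟩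

theorem LCStep.pivot (g : GSLC n) {u v : Fin n} (h : g.graph.Adj u v) :
    Relation.ReflTransGen LCStep g (g.pivot u v) := by
  rw [pivot_eq g h]
  exact ((((Relation.ReflTransGen.single ⟨u, rfl⟩).tail ⟨v, rfl⟩).tail ⟨u, rfl⟩).trans
    (LCStep.piCopy _ u)).trans (LCStep.piCopy _ v)

theorem rewrites_of_lcSteps {g g' : GSLC n} (h : Relation.ReflTransGen LCStep g g') :
    Rewrites g g' :=
  Relation.ReflTransGen.mono (fun _ _ h => Or.inl h) _ _ h

end GSLC

/-! ### Swapping a red and a green spider -/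

/-- The Hadamard gate that a colour change leaves on the output of a red spider. -/
noncomputable def colourOp : Colour → cliffordGroup
  | Colour.green => 1
  | Colour.red => cliffH

namespace PhasePolyDiagram

variable {n : ℕ}

theorem toGSLC_vop (D : PhasePolyDiagram n) (w : Fin n) :
    D.toGSLC.vop w = colourOp (D.colour w) * cliffZ (D.phase w).val := by
  cases h : D.colour w <;> simp [toGSLC, colourOp, h]

/-- `g` has the operators of a diagram in phase-polynomial form with colours `c`, except that
operators `X_π` may be left next to the graph state at the vertices in `S`. -/
def IsPhaseFormUpToX (c : Fin n → Colour) (S : Fin n → Prop) (g : GSLC n) : Prop :=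
  (∀ j k, c j = Colour.red → c k = Colour.red → ¬ g.graph.Adj j k) ∧
  ∀ w, ∃ k : ℤ, (c w = Colour.red → Even k) ∧
    (g.vop w = colourOp (c w) * cliffZ k ∨
      S w ∧ g.vop w = colourOp (c w) * cliffZ k * cliffX 2)

theorem IsPhaseFormUpToX.exists_toGSLC_eq {c : Fin n → Colour} {S : Fin n → Prop} {g : GSLC n}
    (h : IsPhaseFormUpToX c S g) (hS : ∀ w, ¬ S w) :
    ∃ D : PhasePolyDiagram n, D.colour = c ∧ D.toGSLC = g := by
  obtain ⟨h1, h2⟩ := h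
  choose k hk hv using h2
  refine ⟨⟨c, fun w => (k w : ZMod 4), g.graph, fun w hw => ?_, h1⟩, rfl, ?_⟩
  · obtain ⟨m, hm⟩ := hk w hw
    simp only [hm, Int.cast_add]
    generalize (m : ZMod 4) = a
    revert a; decide
  · refine GSLC.ext rfl fun w => ?_
    rw [toGSLC_vop, (hv w).resolve_right fun h => hS w h.1]
    congr 1
    exact cliffZ_eq_of_cast_eq (by simp)

/-- At most one application of the `π`-copy rule about `u` removes the operator `X_π` at `u`. The
neighbours only receive `Z_π`, which commutes with `X_π` up to a scalar. -/
theorem IsPhaseFormUpToX.exists_piCopy {c : Fin n → Colour} {S : Fin n → Prop} {g : GSLC n}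
    (h : IsPhaseFormUpToX c S g) (u : Fin n) :
    ∃ g', (g' = g ∨ g' = g.piCopy u) ∧ IsPhaseFormUpToX c (fun w => S w ∧ w ≠ u) g' := by
  obtain ⟨h1, h2⟩ := h
  by_cases hu : ∃ k : ℤ, (c u = Colour.red → Even k) ∧ g.vop u = colourOp (c u) * cliffZ k
  · refine ⟨g, Or.inl rfl, h1, fun w => ?_⟩
    by_cases hw : w = u
    · subst hw
      obtain ⟨k, hk, hv⟩ := hu
      exact ⟨k, hk, Or.inl hv⟩
    · obtain ⟨k, hk, hv⟩ := h2 w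
      exact ⟨k, hk, hv.imp id fun h => ⟨⟨h.1, hw⟩, h.2⟩⟩
  · refine ⟨g.piCopy u, Or.inr rfl, by rwa [GSLC.piCopy_graph], fun w => ?_⟩
    obtain ⟨k, hk, hv⟩ := h2 w
    rw [GSLC.piCopy_vop]
    by_cases hw : w = u
    · subst hw
      refine ⟨k, hk, Or.inl ?_⟩
      rcases hv with hv | hv
      · exact absurd ⟨k, hk, hv⟩ hu
      · rw [if_pos rfl, hv.2, mul_assoc, cliffX_two_mul_self, mul_one]
    · rw [if_neg hw]
      by_cases ha : g.graph.Adj u w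
      · rw [if_pos ha]
        refine ⟨k + 2, fun h => (hk h).add even_two, ?_⟩
        rw [cliffZ_add]
        rcases hv with hv | ⟨hs, hv⟩
        · left; rw [hv, mul_assoc]
        · right
          refine ⟨⟨hs, hw⟩, ?_⟩
          rw [hv]
          simp only [mul_assoc]
          rw [cliffZ_two_mul_cliffX_two]
      · rw [if_neg ha]
        exact ⟨k, hk, hv.imp id fun h => ⟨⟨h.1, hw⟩, h.2⟩⟩

/-- The colours after the red spider `d` and the green spider `f` have swapped roles. -/
def swappedColour (D : PhasePolyDiagram n) (d f j : Fin n) : Colour :=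
  if j = f then Colour.red else if j = d then Colour.green else D.colour j

theorem phase_val_of_red (D : PhasePolyDiagram n) {w : Fin n} (h : D.colour w = Colour.red) :
    Even ((D.phase w).val : ℤ) := by
  rcases D.red_phase w h with h | h <;> rw [h] <;> decide

theorem swappedColour_self_left (D : PhasePolyDiagram n) (d f : Fin n) :
    D.swappedColour d f f = Colour.red := if_pos rfl

theorem swappedColour_self_right (D : PhasePolyDiagram n) {d f : Fin n} (h : d ≠ f) :
    D.swappedColour d f d = Colour.green := by simp [swappedColour, h]

theorem swappedColour_of_ne (D : PhasePolyDiagram n) {d f w : Fin n} (hf : w ≠ f) (hd : w ≠ d) :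
    D.swappedColour d f w = D.colour w := by simp [swappedColour, hf, hd]

theorem eq_or_of_swappedColour_eq_red (D : PhasePolyDiagram n) {d f w : Fin n}
    (h : D.swappedColour d f w = Colour.red) :
    w = f ∨ (w ≠ f ∧ w ≠ d ∧ D.colour w = Colour.red) := by
  unfold swappedColour at h
  split_ifs at h with h1 h2
  · exact Or.inl h1
  · exact Or.inr ⟨h1, h2, h⟩

/-- The case of a phase `± π / 2` at `f`. The two local complementations give `f` the operator
`Z_{±π/2} X_{-π/2} Z_{π/2}`, which is a Hadamard gate up to Pauli operators, and turn the Hadamard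
gate at `d` into a quarter turn about the `Z`-axis, again up to Pauli operators. -/
theorem isPhaseFormUpToX_localComp (D : PhasePolyDiagram n) {d f : Fin n}
    (h : D.LaterConnection d f) (hf : D.phase f = 1 ∨ D.phase f = 3) :
    IsPhaseFormUpToX (D.swappedColour d f) (fun w => w = f ∨ w = d)
      ((D.toGSLC.localComp f).localComp d) := by
  obtain ⟨hd, hfg, hadj, hlt⟩ := h
  have hne : d ≠ f := hlt.ne
  have hadj' := hadj.symm
  have hg : D.toGSLC.graph = D.graph := rfl
  have hind (w : Fin n) (hw : D.colour w = Colour.red) : ¬ D.graph.Adj d w :=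
    D.red_indep d w hd hw
  constructor
  · intro j k hj hk
    simp only [GSLC.localComp_graph, localCompl_adj, hg]
    rcases D.eq_or_of_swappedColour_eq_red hj with rfl | ⟨hj1, hj2, hj3⟩ <;>
    rcases D.eq_or_of_swappedColour_eq_red hk with rfl | ⟨hk1, hk2, hk3⟩
    · simp
    · have := hind k hk3
      simp [hadj, hadj', this, hne, Ne.symm hk1, Ne.symm hk2]
    · have := hind j hj3
      simp [hadj, hadj', this, hne, hj1, Ne.symm hj2, D.graph.adj_comm j k]
    · have h1 := hind j hj3
      have h2 := hind k hk3
      have h3 := D.red_indep j k hj3 hk3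
      simp [hadj', h1, h2, h3, Ne.symm hj2, Ne.symm hk2]
      tauto
  · have e2 : cliffZ 1 * cliffZ 1 = cliffZ 2 := by rw [← cliffZ_add]; rfl
    have hdf : (D.toGSLC.localComp f).graph.Adj d f := by
      rw [GSLC.localComp_graph, SimpleGraph.adj_comm, localCompl_adj_left]
      exact hadj'
    have hv₁ : ((D.toGSLC.localComp f).localComp d).vop f =
        cliffZ ((D.phase f).val + 1) * cliffH * cliffZ 2 := by
      rw [GSLC.localComp_vop_of_adj _ hdf, GSLC.localComp_vop_self, toGSLC_vop, hfg, colourOp,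
        cliffX_neg_one, cliffZ_add, ← e2, one_mul]
      simp only [mul_assoc]
    have hv₂ : ((D.toGSLC.localComp f).localComp d).vop d =
        cliffH * cliffZ ((D.phase d).val + 2) * cliffH * cliffZ 1 := by
      rw [GSLC.localComp_vop_self, GSLC.localComp_vop_of_adj _ (by exact hadj'), toGSLC_vop, hd,
        colourOp, cliffX_neg_one, cliffZ_add, ← e2]
      simp only [mul_assoc]
    intro w
    by_cases hwf : w = f
    · subst hwf
      refine ⟨2, fun _ => even_two, ?_⟩
      rw [swappedColour_self_left, hv₁, colourOp]
      rcases hf with hf | hf <;> rw [hf]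
      · right
        refine ⟨Or.inl rfl, ?_⟩
        rw [mul_assoc cliffH, cliffZ_two_mul_cliffX_two, ← mul_assoc, cliffH_mul_cliffX_two]
        rfl
      · left
        have h4 : cliffZ ((3 : ZMod 4).val + 1) = 1 := cliffZ_four
        rw [h4, one_mul]
    by_cases hwd : w = d
    · subst hwd
      rw [D.swappedColour_self_right hne, hv₂, colourOp]
      simp only [reduceCtorEq, false_imp_iff, true_and, or_true, one_mul]
      rcases D.red_phase w hd with hp | hp <;> rw [hp]
      · refine ⟨-1, Or.inr ?_⟩
        have h0 : cliffH * cliffZ ((0 : ZMod 4).val + 2) * cliffH = cliffX 2 := rfl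
        have h1 := cliffZ_one_mul_cliffX_two
        have h2 : cliffZ 1 = (cliffZ (-1))⁻¹ := by
          rw [eq_inv_iff_mul_eq_one, ← cliffZ_add]; exact cliffZ_zero
        rw [h0, h2]
        rw [h2, inv_mul_eq_iff_eq_mul] at h1
        rw [mul_inv_eq_iff_eq_mul, mul_assoc]
        exact h1
      · refine ⟨1, Or.inl ?_⟩
        have h4 : cliffZ ((2 : ZMod 4).val + 2) = 1 := cliffZ_four
        rw [h4, mul_one, cliffH_mul_self, one_mul]
    rw [D.swappedColour_of_ne hwf hwd]
    cases hc : D.colour w with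
    | green =>
      suffices h : ∃ k : ℤ, ((D.toGSLC.localComp f).localComp d).vop w =
          colourOp Colour.green * cliffZ k from h.imp fun k hk => ⟨nofun, Or.inl hk⟩
      rw [GSLC.localComp_vop, if_neg hwd, GSLC.localComp_vop, if_neg hwf, toGSLC_vop, hc]
      split_ifs <;> (try simp only [mul_assoc, ← cliffZ_add]) <;> exact ⟨_, rfl⟩
    | red =>
      -- `w` is not adjacent to `d`, and becomes adjacent to it if it is adjacent to `f`; so it
      -- receives either no phase at all or `Z_{π/2}` twice.
      have hi := hind w hc
      have hp := D.phase_val_of_red hc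
      have hi' : (D.toGSLC.localComp f).graph.Adj d w ↔ D.graph.Adj f w := by
        simp [GSLC.localComp_graph, localCompl_adj, hg, hi, hadj', Ne.symm hwd]
      by_cases ha : D.graph.Adj f w
      · refine ⟨(D.phase w).val + 2, fun _ => hp.add even_two, Or.inl ?_⟩
        rw [GSLC.localComp_vop_of_adj _ (hi'.2 ha), GSLC.localComp_vop_of_adj _ (by exact ha),
          toGSLC_vop, hc, cliffZ_add, ← e2]
        simp only [mul_assoc]
      · refine ⟨(D.phase w).val, fun _ => hp, Or.inl ?_⟩
        rw [GSLC.localComp_vop_of_not_adj _ hwd (mt hi'.1 ha),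
          GSLC.localComp_vop_of_not_adj _ hwf (by exact ha), toGSLC_vop, hc]

/-- The case of a phase `0` or `π` at `f`: the Hadamard gate merged into `f` moves past its Pauli
operator, and the one merged into `d` cancels the one that is there. -/
theorem isPhaseFormUpToX_pivot (D : PhasePolyDiagram n) {d f : Fin n}
    (h : D.LaterConnection d f) (hf : D.phase f = 0 ∨ D.phase f = 2) :
    IsPhaseFormUpToX (D.swappedColour d f) (fun w => w = f ∨ w = d) (D.toGSLC.pivot f d) := by
  obtain ⟨hd, hfg, hadj, hlt⟩ := h
  have hne : d ≠ f := hlt.ne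
  have hadj' := hadj.symm
  have hg : D.toGSLC.graph = D.graph := rfl
  have hind (w : Fin n) (hw : D.colour w = Colour.red) : ¬ D.graph.Adj d w :=
    D.red_indep d w hd hw
  constructor
  · intro j k hj hk
    simp only [GSLC.pivot, pivotGraph, localCompl_adj, hg]
    rcases D.eq_or_of_swappedColour_eq_red hj with rfl | ⟨hj1, hj2, hj3⟩ <;>
    rcases D.eq_or_of_swappedColour_eq_red hk with rfl | ⟨hk1, hk2, hk3⟩
    · simp
    · have := hind k hk3
      simp [hadj, hadj', this, hne, Ne.symm hk1, Ne.symm hk2]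
    · have := hind j hj3
      simp [hadj, hadj', this, hne, hj1, Ne.symm hj1, Ne.symm hj2,
        D.graph.adj_comm j k]
    · have h1 := hind j hj3
      have h2 := hind k hk3
      have h3 := D.red_indep j k hj3 hk3
      simp [hadj, hadj', h1, h2, h3, hne, Ne.symm hj1, Ne.symm hk1, Ne.symm hj2,
        Ne.symm hk2]
      tauto
  · intro w
    simp only [GSLC.pivot, hg, toGSLC_vop]
    by_cases hwf : w = f
    · subst hwf
      refine ⟨0, fun _ => Even.zero, ?_⟩
      simp only [swappedColour_self_left, hfg, colourOp, true_or, if_true, true_and, one_mul,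
        cliffZ_zero, mul_one]
      rcases hf with hf | hf <;> rw [hf]
      · left; exact (congrArg (· * cliffH) cliffZ_zero).trans (one_mul _)
      · right; exact cliffH_mul_cliffX_two.symm
    by_cases hwd : w = d
    · subst hwd
      refine ⟨0, fun _ => Even.zero, ?_⟩
      simp only [D.swappedColour_self_right hne, hd, colourOp, or_true, if_true, true_and, one_mul,
        cliffZ_zero]
      rcases D.red_phase w hd with hp | hp <;> rw [hp]
      · left
        have h0 : cliffZ (0 : ZMod 4).val = 1 := cliffZ_zero
        rw [h0, mul_one, cliffH_mul_self]
      · right; rfl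
    rw [D.swappedColour_of_ne hwf hwd]
    simp only [hwf, hwd, or_self, if_false]
    cases hc : D.colour w with
    | green =>
      split_ifs
      · refine ⟨(D.phase w).val + 2, nofun, Or.inl ?_⟩
        rw [mul_assoc, ← cliffZ_add]
      · exact ⟨_, nofun, Or.inl rfl⟩
    | red =>
      rw [if_neg fun h => hind w hc h.2]
      exact ⟨_, fun _ => D.phase_val_of_red hc, Or.inl rfl⟩

/-- Every swap can be completed to a diagram in phase-polynomial form. -/
theorem exists_swapAt (D : PhasePolyDiagram n) {d f : Fin n} (h : D.LaterConnection d f) :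
    ∃ D', SwapAt d f D D' := by
  have hx : IsPhaseFormUpToX (D.swappedColour d f) (fun w => w = f ∨ w = d)
      (D.exchange d f) := by
    unfold exchange
    split_ifs with hf
    · exact D.isPhaseFormUpToX_localComp h hf
    · refine D.isPhaseFormUpToX_pivot h ?_
      generalize D.phase f = a at hf
      revert a; decide
  obtain ⟨g₁, hg₁, hx₁⟩ := hx.exists_piCopy f
  obtain ⟨g₂, hg₂, hx₂⟩ := hx₁.exists_piCopy d
  obtain ⟨D', hc, rfl⟩ := hx₂.exists_toGSLC_eq (by tauto)
  refine ⟨D', ?_, ?_, ?_, ?_⟩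
  · have s₁ : Relation.ReflTransGen (fun g g' : GSLC n => g' = g.piCopy f ∨ g' = g.piCopy d)
        (D.exchange d f) g₁ := by
      rcases hg₁ with rfl | rfl
      · exact .refl
      · exact .single (Or.inl rfl)
    rcases hg₂ with h | h
    · rwa [h]
    · exact s₁.tail (Or.inr h)
  · simp [hc, swappedColour]
  · simp [hc, swappedColour, h.2.2.2.ne]
  · intro j hjd hjf
    simp [hc, swappedColour, hjd, hjf]

theorem LaterConnection.exchange_lcSteps {D : PhasePolyDiagram n} {d f : Fin n}
    (h : D.LaterConnection d f) :
    Relation.ReflTransGen GSLC.LCStep D.toGSLC (D.exchange d f) := by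
  unfold exchange
  split_ifs
  · exact (Relation.ReflTransGen.single ⟨f, rfl⟩).tail ⟨d, rfl⟩
  · exact GSLC.LCStep.pivot _ h.2.2.1.symm

theorem SwapStep.lcSteps {D D' : PhasePolyDiagram n} (h : SwapStep D D') :
    Relation.ReflTransGen GSLC.LCStep D.toGSLC D'.toGSLC := by
  obtain ⟨d, f, hdf, hs, -⟩ := h
  refine hdf.exchange_lcSteps.trans ?_
  generalize D'.toGSLC = g at hs
  induction hs with
  | refl => exact .refl
  | tail _ hbc ih =>
    rcases hbc with rfl | rfl
    · exact ih.trans (GSLC.LCStep.piCopy _ f)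
    · exact ih.trans (GSLC.LCStep.piCopy _ d)

open Classical in
/-- The sum of the positions of the green spiders; every swap moves a green spider forward. -/
noncomputable def greenWeight (D : PhasePolyDiagram n) : ℕ :=
  ∑ j with D.colour j = Colour.green, (j : ℕ)

theorem SwapStep.greenWeight_lt {D D' : PhasePolyDiagram n} (h : SwapStep D D') :
    D'.greenWeight < D.greenWeight := by
  classical
  obtain ⟨d, f, ⟨hd, hf, -, hlt⟩, -, hf', hd', ho⟩ := h
  have key : Finset.univ.filter (fun j => D'.colour j = Colour.green) =
      insert d ((Finset.univ.filter fun j => D.colour j = Colour.green).erase f) := by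
    ext j
    by_cases h1 : j = d
    · subst h1; simp [hd']
    by_cases h2 : j = f
    · subst h2; simp [hf', h1]
    simp [h1, h2, ho j h1 h2]
  unfold greenWeight
  rw [key, Finset.sum_insert (by simp [hd]),
    ← Finset.add_sum_erase (Finset.univ.filter fun j => D.colour j = Colour.green) _
      (a := f) (by simp [hf])]
  simpa using hlt

end PhasePolyDiagram

/-! ### Powers of the imaginary unit and sums over pairs -/

/-- The character `a ↦ i ^ a` of the integers modulo `4`. -/
noncomputable def iPow : AddChar (ZMod 4) ℂ := AddChar.zmodChar 4 Complex.I_pow_four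

theorem iPow_apply (a : ZMod 4) : iPow a = Complex.I ^ a.val := rfl

theorem iPow_one : iPow 1 = Complex.I := pow_one _

theorem iPow_two : iPow 2 = -1 := Complex.I_sq

theorem iPow_three : iPow 3 = -Complex.I := Complex.I_pow_three

theorem iPow_ne_zero (a : ZMod 4) : iPow a ≠ 0 := pow_ne_zero _ Complex.I_ne_zero

theorem iPow_sum {ι : Type*} (s : Finset ι) (f : ι → ZMod 4) :
    iPow (∑ i ∈ s, f i) = ∏ i ∈ s, iPow (f i) := by
  classical
  induction s using Finset.induction_on with
  | empty => simp
  | insert a s ha ih => rw [Finset.sum_insert ha, Finset.prod_insert ha, AddChar.map_add_eq_mul, ih]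

/-- The representative `0` or `1` of a bit, modulo `4`. -/
def bit4 (b : ZMod 2) : ZMod 4 := (b.val : ZMod 4)

theorem bit4_mul_self (b : ZMod 2) : bit4 b * bit4 b = bit4 b := by revert b; decide

/-- Doubling turns the representatives of bits into an additive map. -/
def doubleBit : ZMod 2 →+ ZMod 4 where
  toFun b := 2 * bit4 b
  map_zero' := by decide
  map_add' := by decide

theorem doubleBit_apply (b : ZMod 2) : doubleBit b = 2 * bit4 b := rfl

section PairSum

variable {n : ℕ} {R : Type*} [CommRing R]

/-- The sum over all pairs `i < j`. -/
def pairSum (f : Fin n → Fin n → R) : R := ∑ i, ∑ j, if i < j then f i j else 0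

theorem pairSum_add (f g : Fin n → Fin n → R) :
    pairSum (fun i j => f i j + g i j) = pairSum f + pairSum g := by
  simp only [pairSum, ← Finset.sum_add_distrib]
  refine Finset.sum_congr rfl fun i _ => Finset.sum_congr rfl fun j _ => ?_
  split_ifs <;> simp

theorem pairSum_add_swap (h : Fin n → Fin n → R) :
    pairSum (fun i j => h i j + h j i) + ∑ i, h i i = ∑ i, ∑ j, h i j := by
  have h1 : pairSum (fun i j => h j i) = ∑ i, ∑ j, if j < i then h i j else 0 :=
    Finset.sum_comm
  have h2 : ∑ i, h i i = ∑ i, ∑ j, if j = i then h i j else 0 := by simp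
  rw [pairSum_add, h1, h2, pairSum]
  simp only [← Finset.sum_add_distrib]
  refine Finset.sum_congr rfl fun i _ => Finset.sum_congr rfl fun j _ => ?_
  rcases lt_trichotomy i j with h | h | h
  · simp [h, h.not_gt, h.ne']
  · simp [h]
  · simp [h, h.not_gt, h.ne]

/-- If no two indices in `P` are paired by `f`, the pairs that meet `P` can be summed by their
element in `P`. -/
theorem pairSum_split (f : Fin n → Fin n → R) (P : Fin n → Prop) [DecidablePred P]
    (hs : ∀ i j, f i j = f j i) (hP : ∀ i j, P i → P j → f i j = 0) :
    pairSum f = pairSum (fun i j => if ¬ P i ∧ ¬ P j then f i j else 0) +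
      ∑ i, if P i then ∑ j, f i j else 0 := by
  have h := pairSum_add_swap fun i j => if P i then f i j else 0
  have hd : ∑ i, (if P i then f i i else 0) = 0 :=
    Finset.sum_eq_zero fun i _ => by split_ifs with h; exacts [hP i i h h, rfl]
  have hr : (∑ i, if P i then ∑ j, f i j else 0) = ∑ i, ∑ j, if P i then f i j else 0 :=
    Finset.sum_congr rfl fun i _ => by split_ifs <;> simp
  rw [hd, add_zero, ← hr] at h
  rw [← h, ← pairSum_add]
  congr 1
  funext i j
  by_cases hi : P i <;> by_cases hj : P j <;> simp [hi, hj, hP]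
  exact hs i j

end PairSum

/-! ### Graph states -/

section GraphState

variable {n : ℕ}

open Classical in
/-- The number of neighbours `j` of `u` with `y j = 1`, modulo `4`. -/
noncomputable def nbrSum (G : SimpleGraph (Fin n)) (u : Fin n) (y : Fin n → ZMod 2) : ZMod 4 :=
  ∑ j, if G.Adj u j then bit4 (y j) else 0

open Classical in
/-- The phase of a graph state at `y`: twice the number of edges both of whose ends have the value
`1`, as an exponent of the imaginary unit. -/
noncomputable def graphPhase (G : SimpleGraph (Fin n)) (y : Fin n → ZMod 2) : ZMod 4 :=
  2 * pairSum fun i j => if G.Adj i j then bit4 (y i) * bit4 (y j) else 0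

/-- The local complementation toggles the pairs among the neighbours of `u`. If `m` neighbours have
the value `1`, twice the number of such pairs with value `1` at both ends is `m * m - m`. -/
theorem graphPhase_localCompl (G : SimpleGraph (Fin n)) (u : Fin n) (y : Fin n → ZMod 2) :
    graphPhase (localCompl G u) y =
      graphPhase G y + (nbrSum G u y * nbrSum G u y - nbrSum G u y) := by
  classical
  let t : Fin n → ZMod 4 := fun j => if G.Adj u j then bit4 (y j) else 0
  have ht : pairSum (fun i j => t i * t j + t j * t i) + ∑ i, t i * t i =
      (∑ i, t i) * ∑ i, t i := by
    rw [pairSum_add_swap fun i j => t i * t j, Finset.sum_mul_sum]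
  have hd : ∑ i, t i * t i = ∑ i, t i :=
    Finset.sum_congr rfl fun i _ => by simp only [t]; split_ifs <;> simp [bit4_mul_self]
  have hn : nbrSum G u y = ∑ i, t i := rfl
  rw [hn, ← ht, hd, add_sub_cancel_right, graphPhase, graphPhase, pairSum, pairSum, pairSum,
    Finset.mul_sum, Finset.mul_sum, ← Finset.sum_add_distrib]
  refine Finset.sum_congr rfl fun i _ => ?_
  rw [Finset.mul_sum, Finset.mul_sum, ← Finset.sum_add_distrib]
  refine Finset.sum_congr rfl fun j _ => ?_
  by_cases hij : i < j
  · simp only [hij, if_true, localCompl_adj, t]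
    generalize bit4 (y i) = a
    generalize bit4 (y j) = b
    by_cases h1 : G.Adj i j <;> by_cases h2 : G.Adj u i <;> by_cases h3 : G.Adj u j <;>
      simp [h1, h2, h3, hij.ne] <;> revert a b <;> decide
  · simp [hij]

theorem graphPhase_eq (G : SimpleGraph (Fin n)) (u : Fin n) (y : Fin n → ZMod 2) :
    graphPhase G y = graphPhase G (Function.update y u 0) + 2 * bit4 (y u) * nbrSum G u y := by
  classical
  have key (z : Fin n → ZMod 2) := pairSum_split
    (fun i j => if G.Adj i j then bit4 (z i) * bit4 (z j) else 0) (fun i => i = u)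
    (fun i j => by simp only [G.adj_comm i j, mul_comm]) (fun i j hi hj => by simp [hi, hj])
  simp only [Finset.sum_ite_eq', Finset.mem_univ, if_true] at key
  rw [graphPhase, graphPhase, key, key, mul_add, mul_add, add_assoc]
  congr 1
  · congr 2
    funext i j
    split_ifs with h
    · simp [Function.update_of_ne h.1, Function.update_of_ne h.2]
    · rfl
    · rfl
  · have h0 : bit4 0 = 0 := by decide
    simp [h0, nbrSum, Finset.mul_sum, mul_assoc]

theorem nbrSum_update (G : SimpleGraph (Fin n)) (u : Fin n) (y : Fin n → ZMod 2) (b : ZMod 2) :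
    nbrSum G u (Function.update y u b) = nbrSum G u y := by
  classical
  refine Finset.sum_congr rfl fun j _ => ?_
  split_ifs with h
  · rw [Function.update_of_ne (G.ne_of_adj h).symm]
  · rfl

theorem graphPhase_update (G : SimpleGraph (Fin n)) (u : Fin n) (y : Fin n → ZMod 2)
    (b : ZMod 2) : graphPhase G (Function.update y u b) =
      graphPhase G y + 2 * (bit4 b - bit4 (y u)) * nbrSum G u y := by
  rw [graphPhase_eq G u, graphPhase_eq G u y, nbrSum_update]
  simp
  ring

/-- The entry of a matrix at two bits. -/
def bitEntry (A : Matrix (Fin 2) (Fin 2) ℂ) (a b : ZMod 2) : ℂ := A a b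

theorem bitEntry_mul (A B : Matrix (Fin 2) (Fin 2) ℂ) (a c : ZMod 2) :
    bitEntry (A * B) a c = ∑ b : ZMod 2, bitEntry A a b * bitEntry B b c :=
  Matrix.mul_apply

/-- The vector of a graph state followed by the matrices `M w` on its outputs. -/
noncomputable def graphStateVec (G : SimpleGraph (Fin n))
    (M : Fin n → Matrix (Fin 2) (Fin 2) ℂ) (x : Fin n → ZMod 2) : ℂ :=
  ∑ y : Fin n → ZMod 2, (∏ w, bitEntry (M w) (x w) (y w)) * iPow (graphPhase G y)

/-- Operators merged next to a graph state: if `N` turns the graph state of `G'` into that of `G`,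
then `M * N` on `G'` gives the same vector as `M` on `G`. -/
theorem graphStateVec_mul {G G' : SimpleGraph (Fin n)}
    (M N : Fin n → Matrix (Fin 2) (Fin 2) ℂ) {c : ℂ}
    (h : ∀ z, graphStateVec G' N z = c * iPow (graphPhase G z)) (x : Fin n → ZMod 2) :
    graphStateVec G' (fun w => M w * N w) x = c * graphStateVec G M x := by
  simp only [graphStateVec, bitEntry_mul, Finset.mul_sum]
  simp_rw [Finset.prod_univ_sum, Finset.sum_mul, Fintype.piFinset_univ]
  rw [Finset.sum_comm]
  refine Finset.sum_congr rfl fun z _ => ?_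
  rw [mul_left_comm, ← h z, graphStateVec, Finset.mul_sum]
  refine Finset.sum_congr rfl fun y _ => ?_
  rw [Finset.prod_mul_distrib, mul_assoc]

end GraphState

/-! ### Soundness of local complementation -/

/-- The Hadamard gate as an invertible matrix, up to normalisation. -/
noncomputable def glH : GL (Fin 2) ℂ :=
  GeneralLinearGroup.mkOfDetNeZero !![(1 : ℂ), 1; 1, -1] (by norm_num [Matrix.det_fin_two])

/-- The phase gate as an invertible matrix. -/
noncomputable def glS : GL (Fin 2) ℂ :=
  GeneralLinearGroup.mkOfDetNeZero !![(1 : ℂ), 0; 0, Complex.I] (by simp [Matrix.det_fin_two])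

theorem glS_pow (k : ℕ) : ((glS ^ k : GL (Fin 2) ℂ) : Matrix (Fin 2) (Fin 2) ℂ) =
    !![1, 0; 0, Complex.I ^ k] := by
  have h : ((glS : GL (Fin 2) ℂ) : Matrix (Fin 2) (Fin 2) ℂ) =
      Matrix.diagonal ![1, Complex.I] := by
    ext i j; fin_cases i <;> fin_cases j <;> simp [glS]
  rw [Units.val_pow_eq_pow_val, h, Matrix.diagonal_pow]
  ext i j; fin_cases i <;> fin_cases j <;> simp

theorem mk_glH : ProjGenLinGroup.mk glH = (cliffH : PGL2) := rfl

theorem mk_glS_pow (k : ℕ) : ProjGenLinGroup.mk (glS ^ k) = (cliffZ k : PGL2) := by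
  rw [map_pow, cliffZ, zpow_natCast]
  rfl

theorem mk_glX : ProjGenLinGroup.mk (glH * glS ^ 3 * glH) = (cliffX (-1) : PGL2) := by
  have h : cliffZ (-1) = cliffZ (3 : ℕ) := cliffZ_eq_of_cast_eq (by decide)
  rw [cliffX, h, map_mul, map_mul, mk_glS_pow]
  rfl

theorem bitEntry_fin_two (p q r s : ℂ) :
    bitEntry !![p, q; r, s] 0 0 = p ∧ bitEntry !![p, q; r, s] 0 1 = q ∧
      bitEntry !![p, q; r, s] 1 0 = r ∧ bitEntry !![p, q; r, s] 1 1 = s :=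
  ⟨rfl, rfl, rfl, rfl⟩

theorem zmod_two_eq (a : ZMod 2) : a = 0 ∨ a = 1 := by revert a; decide

theorem bit4_zero : bit4 0 = 0 := by decide

theorem bit4_one : bit4 1 = 1 := by decide

theorem bitEntry_glS_pow (k : ZMod 4) (a b : ZMod 2) :
    bitEntry (glS ^ k.val : GL (Fin 2) ℂ) a b = if b = a then iPow (k * bit4 a) else 0 := by
  rw [glS_pow]
  rcases zmod_two_eq a with rfl | rfl <;> rcases zmod_two_eq b with rfl | rfl <;>
    simp [bit4_zero, bit4_one, bitEntry_fin_two, iPow_apply]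

theorem bitEntry_glH_mul_glS_pow (k : ZMod 4) (a b : ZMod 2) :
    bitEntry (glH * glS ^ k.val : GL (Fin 2) ℂ) a b =
      iPow (2 * bit4 a * bit4 b + k * bit4 b) := by
  rw [Units.val_mul, glS_pow, AddChar.map_add_eq_mul]
  rcases zmod_two_eq a with rfl | rfl <;> rcases zmod_two_eq b with rfl | rfl <;>
    simp [bit4_zero, bit4_one, bitEntry_fin_two, glH, iPow_two] <;> simp [iPow_apply]

theorem bitEntry_glX (a b : ZMod 2) :
    bitEntry (glH * glS ^ 3 * glH : GL (Fin 2) ℂ) a b =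
      if a = b then 1 - Complex.I else 1 + Complex.I := by
  rw [Units.val_mul, Units.val_mul, glS_pow]
  rcases zmod_two_eq a with rfl | rfl <;> rcases zmod_two_eq b with rfl | rfl <;>
    simp [bitEntry_fin_two, glH, Complex.I_pow_three, sub_eq_add_neg]

section Soundness

variable {n : ℕ}

open Classical in
/-- The operators that a local complementation about `u` merges into a graph state. -/
noncomputable def localCompGate (G : SimpleGraph (Fin n)) (u w : Fin n) : GL (Fin 2) ℂ :=
  if w = u then glH * glS ^ 3 * glH else if G.Adj u w then glS else 1

/-- The sum that remains at the vertex of a local complementation. -/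
theorem sum_glX_mul_iPow (m : ZMod 4) (a : ZMod 2) :
    ∑ b : ZMod 2, bitEntry (glH * glS ^ 3 * glH : GL (Fin 2) ℂ) a b *
      iPow (m * m + 2 * (bit4 b - bit4 a) * m) = 2 := by
  have hm : ∀ m : ZMod 4,
      (∀ a b : ZMod 2, m * m + 2 * (bit4 b - bit4 a) * m = 0) ∨
      (∀ a b : ZMod 2, m * m + 2 * (bit4 b - bit4 a) * m = if a = b then 1 else 3) := by
    decide
  have hs : ∀ f : ZMod 2 → ℂ, ∑ b, f b = f 0 + f 1 := fun f => Fin.sum_univ_two f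
  have hI := Complex.I_sq
  rw [hs]
  simp only [bitEntry_glX]
  rcases hm m with h | h <;> simp only [h] <;> rcases zmod_two_eq a with rfl | rfl <;>
    simp [iPow_one, iPow_three] <;> first | ring1 | linear_combination (-2) * hI

/-- Local complementation preserves the graph state, up to a scalar. -/
theorem graphStateVec_localCompl (G : SimpleGraph (Fin n)) (u : Fin n) (z : Fin n → ZMod 2) :
    graphStateVec (localCompl G u) (fun w => localCompGate G u w) z =
      2 * iPow (graphPhase G z) := by
  classical
  have hS (a b : ZMod 2) : bitEntry (glS : GL (Fin 2) ℂ) a b =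
      if b = a then iPow (bit4 a) else 0 := by
    have h := bitEntry_glS_pow 1 a b
    rwa [one_mul, show (1 : ZMod 4).val = 1 from rfl, pow_one] at h
  have hI (a b : ZMod 2) : bitEntry ((1 : GL (Fin 2) ℂ) : Matrix (Fin 2) (Fin 2) ℂ) a b =
      if b = a then 1 else 0 := by
    simpa using! bitEntry_glS_pow 0 a b
  -- Away from `u` the operators are diagonal, so only `z` and its flip at `u` contribute.
  have hsub : graphStateVec (localCompl G u) (fun w => localCompGate G u w) z =
      ∑ b : ZMod 2, (∏ w, bitEntry (localCompGate G u w) (z w) (Function.update z u b w)) *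
        iPow (graphPhase (localCompl G u) (Function.update z u b)) := by
    rw [graphStateVec, ← Finset.sum_image (s := Finset.univ) (g := fun b => Function.update z u b)
      (f := fun y => (∏ w, bitEntry (localCompGate G u w) (z w) (y w)) *
        iPow (graphPhase (localCompl G u) y)) ((Function.update_injective z u).injOn)]
    refine (Finset.sum_subset (Finset.subset_univ _) fun y _ hy => ?_).symm
    obtain ⟨w, hwu, hw⟩ : ∃ w, w ≠ u ∧ y w ≠ z w := by
      by_contra! hcon
      refine hy (Finset.mem_image.2 ⟨y u, Finset.mem_univ _, ?_⟩)
      funext w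
      by_cases hw : w = u
      · subst hw; simp
      · simp [hw, hcon w hw]
    rw [Finset.prod_eq_zero (Finset.mem_univ w), zero_mul]
    simp only [localCompGate, if_neg hwu]
    split_ifs
    · rw [hS, if_neg hw]
    · rw [hI, if_neg hw]
  have hprod (b : ZMod 2) :
      ∏ w, bitEntry (localCompGate G u w) (z w) (Function.update z u b w) =
        bitEntry (glH * glS ^ 3 * glH : GL (Fin 2) ℂ) (z u) b * iPow (nbrSum G u z) := by
    rw [← Finset.mul_prod_erase _ _ (Finset.mem_univ u)]
    congr 1
    · simp [localCompGate]
    · rw [nbrSum, iPow_sum, ← Finset.mul_prod_erase _ _ (Finset.mem_univ u)]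
      simp only [SimpleGraph.irrefl, if_false, AddChar.map_zero_eq_one, one_mul]
      refine Finset.prod_congr rfl fun w hw => ?_
      have hwu := (Finset.mem_erase.1 hw).1
      rw [Function.update_of_ne hwu]
      simp only [localCompGate, if_neg hwu]
      split_ifs
      · rw [hS, if_pos rfl]
      · rw [hI, if_pos rfl, AddChar.map_zero_eq_one]
  rw [hsub, ← sum_glX_mul_iPow (nbrSum G u z) (z u), Finset.sum_mul]
  refine Finset.sum_congr rfl fun b _ => ?_
  rw [hprod, graphPhase_localCompl, graphPhase_update, nbrSum_update, mul_assoc (bitEntry _ _ _),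
    mul_assoc (bitEntry _ _ _), ← AddChar.map_add_eq_mul, ← AddChar.map_add_eq_mul]
  congr 2
  ring

/-- The vector `ψ` is, up to a nonzero scalar, the state that a GS-LC form diagram describes. As
the operators of the diagram are only given up to scalars, representatives are chosen. -/
def GSLC.Represents (g : GSLC n) (ψ : (Fin n → ZMod 2) → ℂ) : Prop :=
  ∃ M : Fin n → GL (Fin 2) ℂ, (∀ w, ProjGenLinGroup.mk (M w) = (g.vop w : PGL2)) ∧
    ∃ c : ℂ, c ≠ 0 ∧ ∀ x, ψ x = c * graphStateVec g.graph (fun w => M w) x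

theorem GSLC.Represents.localComp {g : GSLC n} {ψ : (Fin n → ZMod 2) → ℂ} (h : g.Represents ψ)
    (u : Fin n) : (g.localComp u).Represents ψ := by
  obtain ⟨M, hM, c, hc, hψ⟩ := h
  refine ⟨fun w => M w * localCompGate g.graph u w, fun w => ?_, c / 2, by simpa using hc,
    fun x => ?_⟩
  · have hZ : ProjGenLinGroup.mk glS = (cliffZ 1 : PGL2) := by
      simpa using! mk_glS_pow 1
    rw [GSLC.localComp_vop, map_mul, hM, localCompGate]
    split_ifs
    · rw [mk_glX]; rfl
    · rw [hZ]; rfl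
    · rw [map_one, mul_one]
  · rw [hψ, GSLC.localComp_graph]
    have := graphStateVec_mul (fun w => (M w : Matrix (Fin 2) (Fin 2) ℂ))
      (fun w => (localCompGate g.graph u w : Matrix (Fin 2) (Fin 2) ℂ))
      (graphStateVec_localCompl g.graph u) x
    simp only [Units.val_mul]
    rw [this]
    ring

theorem GSLC.Represents.lcSteps {g g' : GSLC n} {ψ : (Fin n → ZMod 2) → ℂ}
    (h : g.Represents ψ) (hs : Relation.ReflTransGen LCStep g g') : g'.Represents ψ := by
  induction hs with
  | refl => exact h
  | tail _ hbc ih =>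
    obtain ⟨u, rfl⟩ := hbc
    exact ih.localComp u

/-- A GS-LC form diagram determines its state up to a scalar: other representatives of the operators
rescale the vector by the product of the factors. -/
theorem GSLC.Represents.eq_smul {g : GSLC n} {ψ ψ' : (Fin n → ZMod 2) → ℂ}
    (h : g.Represents ψ) (h' : g.Represents ψ') : ∃ c : ℂ, c ≠ 0 ∧ ∀ x, ψ x = c * ψ' x := by
  obtain ⟨M, hM, c, hc, hψ⟩ := h
  obtain ⟨M', hM', c', hc', hψ'⟩ := h'
  have hu (w : Fin n) : ∃ u : ℂˣ, M' w * .scalar (Fin 2) u = M w :=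
    ProjGenLinGroup.mk_eq_mk_iff.1 ((hM' w).trans (hM w).symm)
  choose u hu using hu
  have hv (x) : graphStateVec g.graph (fun w => M w) x =
      (∏ w, (u w : ℂ)) * graphStateVec g.graph (fun w => M' w) x := by
    rw [graphStateVec, graphStateVec, Finset.mul_sum]
    refine Finset.sum_congr rfl fun y _ => ?_
    rw [← mul_assoc, ← Finset.prod_mul_distrib]
    congr 1
    refine Finset.prod_congr rfl fun w _ => ?_
    rw [← hu w]
    simp only [bitEntry, Units.val_mul, GeneralLinearGroup.coe_scalar, Matrix.scalar_apply]
    exact (Matrix.mul_diagonal _ _ _ _).trans (mul_comm _ _)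
  refine ⟨c * (∏ w, (u w : ℂ)) / c', ?_, fun x => ?_⟩
  · exact div_ne_zero (mul_ne_zero hc (Finset.prod_ne_zero_iff.2 fun w _ => (u w).ne_zero)) hc'
  · rw [hψ, hψ', hv]
    field_simp

end Soundness

/-! ### The vector of a diagram in phase-polynomial form -/

namespace PhasePolyDiagram

variable {n : ℕ}

open Classical in
/-- The affine equation that a red spider `k` imposes. -/
def ParityAt (D : PhasePolyDiagram n) (k : Fin n) (x : Fin n → ZMod 2) : Prop :=
  x k = (if D.phase k = 0 then 0 else 1) + ∑ j with D.graph.Adj k j, x j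

open Classical in
/-- The number of edges between green spiders both of which have the value `1`, modulo `4`. -/
noncomputable def greenPairs (D : PhasePolyDiagram n) (x : Fin n → ZMod 2) : ZMod 4 :=
  pairSum fun i j => if D.graph.Adj i j ∧ D.colour i = Colour.green ∧ D.colour j = Colour.green
    then bit4 (x i) * bit4 (x j) else 0

open Classical in
/-- The contribution of a single spider to the vector of a diagram. -/
noncomputable def spiderFactor (D : PhasePolyDiagram n) (x : Fin n → ZMod 2) (k : Fin n) : ℂ :=
  match D.colour k with
  | Colour.green => iPow (D.phase k * bit4 (x k))
  | Colour.red => if D.ParityAt k x then 1 else 0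

/-- The vector of a diagram, without normalisation. -/
noncomputable def formVec (D : PhasePolyDiagram n) (x : Fin n → ZMod 2) : ℂ :=
  iPow (2 * D.greenPairs x) * ∏ k, D.spiderFactor x k

open Classical in
theorem formVec_eq (D : PhasePolyDiagram n) (x : Fin n → ZMod 2) : D.formVec x =
    if ∀ k, D.colour k = Colour.red → D.ParityAt k x then iPow (D.phasePoly x) else 0 := by
  split_ifs with h
  · have h1 : ∀ k, D.spiderFactor x k =
        iPow (if D.colour k = Colour.green then D.phase k * bit4 (x k) else 0) := fun k => by
      cases hc : D.colour k with
      | green => simp [spiderFactor, hc]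
      | red => simp [spiderFactor, hc, h k hc]
    rw [formVec, Finset.prod_congr rfl fun k _ => h1 k, ← iPow_sum, ← AddChar.map_add_eq_mul,
      phasePoly, Finset.sum_filter, Finset.sum_filter, Fintype.sum_prod_type, add_comm]
    congr 3
    rw [greenPairs, pairSum]
    refine Finset.sum_congr rfl fun i _ => Finset.sum_congr rfl fun j _ => ?_
    rw [← ite_and]
    rfl
  · push Not at h
    obtain ⟨k, hk, hp⟩ := h
    rw [formVec, Finset.prod_eq_zero (Finset.mem_univ k), mul_zero]
    simp [spiderFactor, hk, hp]

open Classical in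
theorem one_add_iPow_of_red (D : PhasePolyDiagram n) {k : Fin n} (hk : D.colour k = Colour.red)
    (x : Fin n → ZMod 2) :
    1 + iPow (D.phase k + doubleBit ((∑ j with D.graph.Adj k j, x j) + x k)) =
      2 * D.spiderFactor x k := by
  have key : ∀ (p : ZMod 4) (a b : ZMod 2), p = 0 ∨ p = 2 →
      p + doubleBit (a + b) = if b = (if p = 0 then 0 else 1) + a then 0 else 2 := by decide
  rw [key _ _ _ (D.red_phase k hk)]
  have hp : D.ParityAt k x ↔
    x k = (if D.phase k = 0 then 0 else 1) + ∑ j with D.graph.Adj k j, x j := Iff.rfl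
  simp only [spiderFactor, hk]
  by_cases h : D.ParityAt k x
  · rw [if_pos (hp.1 h), if_pos h, AddChar.map_zero_eq_one]; norm_num
  · rw [if_neg (mt hp.2 h), if_neg h, iPow_two]; norm_num

/-- Representatives of the operators in the GS-LC form of a diagram. -/
noncomputable def glOp (D : PhasePolyDiagram n) (w : Fin n) : GL (Fin 2) ℂ :=
  match D.colour w with
  | Colour.green => glS ^ (D.phase w).val
  | Colour.red => glH * glS ^ (D.phase w).val

theorem mk_glOp (D : PhasePolyDiagram n) (w : Fin n) :
    ProjGenLinGroup.mk (D.glOp w) = (D.toGSLC.vop w : PGL2) := by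
  rw [toGSLC_vop]
  cases hc : D.colour w with
  | green => simp only [glOp, hc, colourOp, one_mul]; exact mk_glS_pow _
  | red => simp only [glOp, hc, colourOp, map_mul, mk_glS_pow, mk_glH]; rfl

open Classical in
/-- What is summed over the value `b` of the graph state at `w`, once the values at the green
spiders are fixed by those of the outputs. -/
noncomputable def outputFactor (D : PhasePolyDiagram n) (x : Fin n → ZMod 2) (w : Fin n)
    (b : ZMod 2) : ℂ :=
  match D.colour w with
  | Colour.green => if b = x w then iPow (D.phase w * bit4 (x w)) else 0
  | Colour.red => iPow (2 * bit4 (x w) * bit4 b + D.phase w * bit4 b) *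
      iPow (2 * (bit4 b * nbrSum D.graph w x))

theorem doubleBit_sum_nbr (G : SimpleGraph (Fin n)) [DecidableRel G.Adj] (k : Fin n)
    (x : Fin n → ZMod 2) :
    doubleBit (∑ j with G.Adj k j, x j) = 2 * nbrSum G k x := by
  rw [map_sum, nbrSum, Finset.mul_sum, Finset.sum_filter]
  refine Finset.sum_congr rfl fun j _ => ?_
  by_cases h : G.Adj k j <;> simp [h, doubleBit_apply]

open Classical in
theorem sum_outputFactor (D : PhasePolyDiagram n) (x : Fin n → ZMod 2) (w : Fin n) :
    ∑ b, D.outputFactor x w b =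
      (if D.colour w = Colour.red then 2 else 1) * D.spiderFactor x w := by
  cases hc : D.colour w with
  | green => simp [outputFactor, spiderFactor, hc]
  | red =>
    have hs : ∀ f : ZMod 2 → ℂ, ∑ b, f b = f 0 + f 1 := fun f => Fin.sum_univ_two f
    rw [if_pos rfl, ← D.one_add_iPow_of_red hc, map_add doubleBit,
      doubleBit_sum_nbr, doubleBit_apply, hs]
    simp only [outputFactor, hc, bit4_zero, bit4_one]
    rw [← AddChar.map_add_eq_mul, ← AddChar.map_add_eq_mul]
    congr 1
    · simp
    · congr 1; ring

/-- As red spiders are not connected to each other, an edge joins two green spiders or a red one to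
a green one. -/
theorem graphPhase_eq_of_green (D : PhasePolyDiagram n) (x y : Fin n → ZMod 2)
    (h : ∀ w, D.colour w = Colour.green → y w = x w) :
    graphPhase D.graph y = 2 * D.greenPairs x +
      ∑ w, match D.colour w with
        | Colour.green => 0
        | Colour.red => 2 * (bit4 (y w) * nbrSum D.graph w x) := by
  classical
  have hg (w : Fin n) : ¬ D.colour w = Colour.red ↔ D.colour w = Colour.green := by
    cases D.colour w <;> simp
  rw [graphPhase, pairSum_split _ (fun w => D.colour w = Colour.red)
    (fun i j => by simp only [D.graph.adj_comm i j, mul_comm])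
    (fun i j hi hj => if_neg (D.red_indep i j hi hj)), mul_add, Finset.mul_sum]
  congr 1
  · rw [greenPairs]
    congr 2
    funext i j
    simp only [hg]
    by_cases hi : D.colour i = Colour.green
    · by_cases hj : D.colour j = Colour.green
      · simp [hi, hj, h i hi, h j hj]
      · simp [hj]
    · simp [hi]
  · refine Finset.sum_congr rfl fun w _ => ?_
    cases hc : D.colour w with
    | green => simp
    | red =>
      simp only [if_true, nbrSum, Finset.mul_sum]
      refine Finset.sum_congr rfl fun j _ => ?_
      split_ifs with ha
      · rw [h j ((hg j).1 fun hj => D.red_indep w j hc hj ha)]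
      · simp

open Classical in
theorem graphStateVec_glOp (D : PhasePolyDiagram n) (x : Fin n → ZMod 2) :
    graphStateVec D.graph (fun w => D.glOp w) x =
      (∏ w, if D.colour w = Colour.red then 2 else 1) * D.formVec x := by
  have hterm (y : Fin n → ZMod 2) :
      (∏ w, bitEntry (D.glOp w) (x w) (y w)) * iPow (graphPhase D.graph y) =
        iPow (2 * D.greenPairs x) * ∏ w, D.outputFactor x w (y w) := by
    by_cases h : ∀ w, D.colour w = Colour.green → y w = x w
    · rw [D.graphPhase_eq_of_green x y h, AddChar.map_add_eq_mul, iPow_sum, mul_left_comm,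
        ← Finset.prod_mul_distrib]
      congr 1
      refine Finset.prod_congr rfl fun w _ => ?_
      cases hc : D.colour w with
      | green =>
        simp only [glOp, outputFactor, hc, bitEntry_glS_pow, AddChar.map_zero_eq_one, mul_one]
      | red => simp only [glOp, outputFactor, hc, bitEntry_glH_mul_glS_pow]
    · push Not at h
      obtain ⟨w, hw, hy⟩ := h
      rw [Finset.prod_eq_zero (Finset.mem_univ w), zero_mul,
        Finset.prod_eq_zero (Finset.mem_univ w), mul_zero]
      · simp [outputFactor, hw, hy]
      · simp only [glOp, hw, bitEntry_glS_pow, if_neg hy]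
  rw [graphStateVec, Finset.sum_congr rfl fun y _ => hterm y, ← Finset.mul_sum,
    ← Fintype.piFinset_univ, ← Finset.prod_univ_sum,
    Finset.prod_congr rfl fun w _ => D.sum_outputFactor x w, Finset.prod_mul_distrib, formVec]
  ring

/-! ### Contraction of the ZX-diagram -/

/-- The distinguished leg `l₀` excludes the spider without legs, whose tensor is `1 + i ^ k`. -/
theorem spiderTensor_green (k : ZMod 4) {L : Type} [Fintype L] (b : L → ZMod 2) (l₀ : L)
    [Decidable (∀ l, b l = b l₀)] :
    spiderTensor Colour.green k b = if ∀ l, b l = b l₀ then iPow (k * bit4 (b l₀)) else 0 := by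
  have hp (a : ZMod 2) : (∏ l, if b l = a then (1 : ℂ) else 0) =
      if b l₀ = a ∧ ∀ l, b l = b l₀ then 1 else 0 := by
    split_ifs with h
    · exact Finset.prod_eq_one fun l _ => if_pos ((h.2 l).trans h.1)
    · obtain ⟨l, hl⟩ : ∃ l, b l ≠ a := by
        by_contra! hcon
        exact h ⟨hcon l₀, fun l => (hcon l).trans (hcon l₀).symm⟩
      exact Finset.prod_eq_zero (Finset.mem_univ l) (if_neg hl)
  simp only [spiderTensor, hp]
  rcases zmod_two_eq (b l₀) with h | h <;> split_ifs <;>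
    simp_all [bit4_zero, bit4_one, iPow_apply]

theorem ketPlus_eq (b : ZMod 2) : ketPlus b = 1 / (Real.sqrt 2 : ℂ) := rfl

theorem ketMinus_eq (b : ZMod 2) : ketMinus b = 1 / (Real.sqrt 2 : ℂ) * iPow (doubleBit b) := by
  rw [ketMinus, div_eq_mul_one_div, mul_comm]
  congr 1
  rcases zmod_two_eq b with rfl | rfl
  · simp
  · have : doubleBit 1 = 2 := by decide
    rw [this, iPow_two]
    exact pow_one _

theorem hadamardEntry_eq (a b : ZMod 2) :
    hadamardEntry a b = 1 / (Real.sqrt 2 : ℂ) * iPow (2 * (bit4 a * bit4 b)) := by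
  rw [hadamardEntry]
  rcases zmod_two_eq b with rfl | rfl
  · simp [ketPlus_eq, bit4_zero]
  · rw [if_neg (by decide), ketMinus_eq, bit4_one, mul_one]
    rfl

theorem spiderTensor_red (k : ZMod 4) {L : Type} [Fintype L] (b : L → ZMod 2) :
    spiderTensor Colour.red k b =
      (1 / (Real.sqrt 2 : ℂ)) ^ Fintype.card L * (1 + iPow (k + doubleBit (∑ l, b l))) := by
  simp only [spiderTensor, ketPlus_eq, ketMinus_eq, Finset.prod_mul_distrib, Finset.prod_const,
    Finset.card_univ]
  rw [map_sum, AddChar.map_add_eq_mul, iPow_sum, iPow_apply k]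
  ring

theorem sum_edges {R : Type*} [CommRing R] (G : SimpleGraph (Fin n)) [DecidableRel G.Adj]
    [Fintype {e : Fin n × Fin n // e.1 < e.2 ∧ G.Adj e.1 e.2}] (F : Fin n → Fin n → R) :
    ∑ e : {e : Fin n × Fin n // e.1 < e.2 ∧ G.Adj e.1 e.2}, F e.1.1 e.1.2 =
      pairSum fun i j => if G.Adj i j then F i j else 0 := by
  rw [← Finset.sum_subtype (Finset.univ.filter fun e : Fin n × Fin n => e.1 < e.2 ∧ G.Adj e.1 e.2)
    (by simp) (fun e => F e.1 e.2), Finset.sum_filter, Fintype.sum_prod_type, pairSum]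
  simp only [ite_and]

open Classical in
/-- The only values on the wire ends that contribute to the vector of a diagram at `x`: a plain
wire carries the value of its green end, a Hadamard wire has the value of either end there. -/
noncomputable def wireValue (D : PhasePolyDiagram n) (x : Fin n → ZMod 2)
    (h : D.toZX.E × Bool) : ZMod 2 :=
  if D.colour (D.toZX.endpoint h) = Colour.green then x (D.toZX.endpoint h)
  else x (D.toZX.endpoint (h.1, !h.2))

theorem toZX_had_eq (D : PhasePolyDiagram n) (e : D.toZX.E) : D.toZX.had e = true ↔
    D.colour (D.toZX.src e) = Colour.green ∧ D.colour (D.toZX.tgt e) = Colour.green := by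
  simp [toZX]

theorem colour_other_of_red (D : PhasePolyDiagram n) (e : D.toZX.E) (b : Bool)
    (h : D.colour (D.toZX.endpoint (e, b)) = Colour.red) :
    D.colour (D.toZX.endpoint (e, !b)) = Colour.green := by
  have ha : D.graph.Adj (D.toZX.src e) (D.toZX.tgt e) := e.2.2
  cases hc : D.colour (D.toZX.endpoint (e, !b)) with
  | green => rfl
  | red =>
    cases b
    · exact absurd ha (D.red_indep _ _ h hc)
    · exact absurd ha (D.red_indep _ _ hc h)

open Classical in
/-- The summand of the contraction of a diagram that belongs to the values `w` on the wire ends. -/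
noncomputable def wireTerm (D : PhasePolyDiagram n) (x : Fin n → ZMod 2)
    (w : D.toZX.E × Bool → ZMod 2) : ℂ :=
  letI := D.toZX.fintypeE
  (∏ e : D.toZX.E,
      if D.toZX.had e then hadamardEntry (w (e, true)) (w (e, false))
      else if w (e, true) = w (e, false) then 1 else 0) *
    ∏ v : Fin n, spiderTensor (D.colour v) (D.phase v)
      (Sum.elim (fun h => w h.1) (fun j => x j.1) : D.toZX.Legs v → ZMod 2)

open Classical in
theorem interp_eq_sum (D : PhasePolyDiagram n) (x : Fin n → ZMod 2) :
    letI := D.toZX.fintypeE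
    D.interp x = ∑ w : D.toZX.E × Bool → ZMod 2, D.wireTerm x w := rfl

/-- Every spider has an output, so a green spider forces the value of its output on all its wires,
and a plain wire passes the value on to its red end. -/
theorem wireTerm_eq_zero (D : PhasePolyDiagram n) (x : Fin n → ZMod 2)
    (w : D.toZX.E × Bool → ZMod 2) (hw : w ≠ D.wireValue x) : D.wireTerm x w = 0 := by
  classical
  let _ := D.toZX.fintypeE
  by_contra hne
  rw [wireTerm, mul_eq_zero, not_or, Finset.prod_eq_zero_iff, Finset.prod_eq_zero_iff] at hne
  push Not at hne
  obtain ⟨hE, hV⟩ := hne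
  have hgreen (h : D.toZX.E × Bool) (hc : D.colour (D.toZX.endpoint h) = Colour.green) :
      w h = x (D.toZX.endpoint h) := by
    have h1 := hV (D.toZX.endpoint h) (Finset.mem_univ _)
    rw [hc, spiderTensor_green _ _ (Sum.inr ⟨D.toZX.endpoint h, rfl⟩)] at h1
    exact (ite_ne_right_iff.1 h1).1 (Sum.inl ⟨h, rfl⟩)
  refine hw (funext fun h => ?_)
  rw [wireValue]
  split_ifs with hc
  · exact hgreen h hc
  · obtain ⟨e, b⟩ := h
    have hr : D.colour (D.toZX.endpoint (e, b)) = Colour.red := by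
      cases hc' : D.colour (D.toZX.endpoint (e, b)) with
      | green => exact absurd hc' hc
      | red => rfl
    have ho := D.colour_other_of_red e b hr
    have hh : ¬ D.toZX.had e = true := by
      rw [toZX_had_eq]
      rintro ⟨h1, h2⟩
      cases b
      · exact hc h1
      · exact hc h2
    have h1 := hE e (Finset.mem_univ _)
    rw [if_neg hh] at h1
    have h2 := (ite_ne_right_iff.1 h1).1
    rw [← hgreen _ ho]
    cases b
    · exact h2.symm
    · exact h2

open Classical in
theorem sum_legs_wireValue (D : PhasePolyDiagram n) (x : Fin n → ZMod 2) {v : Fin n}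
    (hv : D.colour v = Colour.red) [Fintype (D.toZX.Legs v)] :
    ∑ l : D.toZX.Legs v, (Sum.elim (fun h => D.wireValue x h.1) (fun j => x j.1) :
      D.toZX.Legs v → ZMod 2) l = (∑ j with D.graph.Adj v j, x j) + x v := by
  let _ := D.toZX.fintypeE
  have h2 : ∑ j : {j : Fin n // D.toZX.out j = v}, x j.1 = x v :=
    (Fintype.sum_eq_single (⟨v, rfl⟩ : {j : Fin n // D.toZX.out j = v})
      fun j hj => absurd (Subtype.ext j.2) hj)
  have h1 : ∑ h : {h : D.toZX.E × Bool // D.toZX.endpoint h = v}, D.wireValue x h.1 =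
      ∑ j with D.graph.Adj v j, x j := by
    have hval : ∀ h : D.toZX.E × Bool, (if D.toZX.endpoint h = v then D.wireValue x h else 0) =
        if D.toZX.endpoint h = v then x (D.toZX.endpoint (h.1, !h.2)) else 0 := fun h => by
      split_ifs with he
      · rw [wireValue, he, hv, if_neg (by simp)]
      · rfl
    rw [← Finset.sum_subtype (Finset.univ.filter fun h => D.toZX.endpoint h = v) (by simp)
      (fun h => D.wireValue x h), Finset.sum_filter, Finset.sum_congr rfl fun h _ => hval h,
      Fintype.sum_prod_type]
    have h3 := sum_edges D.graph fun i j =>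
      (if j = v then x i else 0) + if i = v then x j else 0
    -- Each wire between `v` and `j` is found at its source or at its target, depending on the order
    -- of `v` and `j`; the symmetric sum over pairs covers both.
    have h4 := pairSum_add_swap fun i j => if D.graph.Adj i j then if i = v then x j else 0 else 0
    simp only [SimpleGraph.irrefl, if_false, Finset.sum_const_zero, add_zero] at h4
    calc _ = ∑ e : {e : Fin n × Fin n // e.1 < e.2 ∧ D.graph.Adj e.1 e.2},
          ((if e.1.2 = v then x e.1.1 else 0) + if e.1.1 = v then x e.1.2 else 0) :=
          Finset.sum_congr rfl fun e _ => by
            rw [Fintype.sum_bool]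
            exact congrArg₂ (· + ·) (if_congr Iff.rfl rfl rfl) (if_congr Iff.rfl rfl rfl)
      _ = _ := h3
      _ = _ := by
          rw [Finset.sum_filter]
          trans ∑ i, ∑ j, if D.graph.Adj i j then if i = v then x j else 0 else 0
          · rw [← h4]
            congr 1
            funext i j
            rw [D.graph.adj_comm j i]
            split_ifs <;> ring
          · rw [Finset.sum_eq_single v]
            · simp
            · intro i _ hi
              exact Finset.sum_eq_zero fun j _ => by rw [if_neg hi, ite_self]
            · simp
  have h3 := Fintype.sum_sum_type (Sum.elim
    (fun h : {h : D.toZX.E × Bool // D.toZX.endpoint h = v} => D.wireValue x h.1)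
    (fun j : {j : Fin n // D.toZX.out j = v} => x j.1))
  rw [← h1, ← h2]
  convert h3 <;> rfl

/-- The vector of a diagram is, up to normalisation, the product of the contributions of its green
spiders, their Hadamard edges and the equations of its red spiders. -/
theorem exists_interp_eq (D : PhasePolyDiagram n) :
    ∃ c : ℂ, c ≠ 0 ∧ ∀ x, D.interp x = c * D.formVec x := by
  classical
  let _ := D.toZX.fintypeE
  have hs : (1 / (Real.sqrt 2 : ℂ)) ≠ 0 := by simp
  refine ⟨(∏ e : D.toZX.E, if D.toZX.had e then 1 / (Real.sqrt 2 : ℂ) else 1) *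
    ∏ v : Fin n, if D.colour v = Colour.red then
      (1 / (Real.sqrt 2 : ℂ)) ^ Fintype.card (D.toZX.Legs v) * 2 else 1, ?_, fun x => ?_⟩
  · refine mul_ne_zero (Finset.prod_ne_zero_iff.2 fun e _ => ?_)
      (Finset.prod_ne_zero_iff.2 fun v _ => ?_)
    · split_ifs
      exacts [hs, one_ne_zero]
    · split_ifs
      exacts [mul_ne_zero (pow_ne_zero _ hs) two_ne_zero, one_ne_zero]
  have hE (e : D.toZX.E) :
      (if D.toZX.had e then hadamardEntry (D.wireValue x (e, true)) (D.wireValue x (e, false))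
        else if D.wireValue x (e, true) = D.wireValue x (e, false) then 1 else 0) =
      (if D.toZX.had e then 1 / (Real.sqrt 2 : ℂ) else 1) *
        iPow (if D.toZX.had e then 2 * (bit4 (x (D.toZX.src e)) * bit4 (x (D.toZX.tgt e)))
          else 0) := by
    by_cases hh : D.toZX.had e = true
    · obtain ⟨h1, h2⟩ := (D.toZX_had_eq e).1 hh
      simp only [if_pos hh, hadamardEntry_eq]
      have e1 : D.wireValue x (e, true) = x (D.toZX.tgt e) := if_pos h2
      have e2 : D.wireValue x (e, false) = x (D.toZX.src e) := if_pos h1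
      rw [e1, e2, mul_comm (bit4 _) (bit4 _)]
    · simp only [if_neg hh, AddChar.map_zero_eq_one, mul_one]
      refine if_pos ?_
      have h1 := D.colour_other_of_red e true
      have h2 : ¬ (D.colour (D.toZX.src e) = Colour.green ∧
        D.colour (D.toZX.tgt e) = Colour.green) := mt (D.toZX_had_eq e).2 hh
      have e1 : D.toZX.endpoint (e, true) = D.toZX.tgt e := rfl
      have e2 : D.toZX.endpoint (e, false) = D.toZX.src e := rfl
      simp only [wireValue, e1, e2, Bool.not_true, Bool.not_false] at h1 ⊢
      cases hs : D.colour (D.toZX.src e) <;> cases ht : D.colour (D.toZX.tgt e) <;> simp_all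
  have hV (v : Fin n) : spiderTensor (D.colour v) (D.phase v)
      (Sum.elim (fun h => D.wireValue x h.1) (fun j => x j.1) : D.toZX.Legs v → ZMod 2) =
      (if D.colour v = Colour.red then
        (1 / (Real.sqrt 2 : ℂ)) ^ Fintype.card (D.toZX.Legs v) * 2 else 1) *
        D.spiderFactor x v := by
    cases hc : D.colour v with
    | green =>
      rw [spiderTensor_green _ _ (Sum.inr ⟨v, rfl⟩), if_pos, if_neg (by simp), one_mul]
      · simp [spiderFactor, hc]
      · rintro (⟨h, rfl⟩ | ⟨j, rfl⟩)
        · exact if_pos hc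
        · rfl
    | red =>
      rw [spiderTensor_red, D.sum_legs_wireValue x hc, D.one_add_iPow_of_red hc, if_pos rfl,
        mul_assoc]
  have hP : ∑ e : D.toZX.E, (if D.toZX.had e then
      2 * (bit4 (x (D.toZX.src e)) * bit4 (x (D.toZX.tgt e))) else 0) = 2 * D.greenPairs x := by
    have h3 := sum_edges D.graph fun i j =>
      if D.colour i = Colour.green ∧ D.colour j = Colour.green then
        bit4 (x i) * bit4 (x j) else 0
    have h4 : D.greenPairs x = pairSum fun i j => if D.graph.Adj i j then
        if D.colour i = Colour.green ∧ D.colour j = Colour.green then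
          bit4 (x i) * bit4 (x j) else 0 else 0 := by
      simp only [← ite_and]; rfl
    rw [h4, ← h3, Finset.mul_sum]
    refine Finset.sum_congr rfl fun e _ => ?_
    simp only [toZX_had_eq, mul_ite, mul_zero]
    rfl
  rw [interp_eq_sum, Finset.sum_eq_single (D.wireValue x)
    (fun w _ hw => D.wireTerm_eq_zero x w hw) (by simp), wireTerm,
    Finset.prod_congr rfl fun e _ => hE e, Finset.prod_congr rfl fun v _ => hV v,
    Finset.prod_mul_distrib, Finset.prod_mul_distrib, ← iPow_sum, hP, formVec]
  ring

theorem represents_interp (D : PhasePolyDiagram n) : D.toGSLC.Represents D.interp := by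
  classical
  obtain ⟨c, hc, h⟩ := D.exists_interp_eq
  have hp : (∏ w, if D.colour w = Colour.red then (2 : ℂ) else 1) ≠ 0 :=
    Finset.prod_ne_zero_iff.2 fun w _ => by split_ifs <;> norm_num
  refine ⟨D.glOp, D.mk_glOp, c / ∏ w, if D.colour w = Colour.red then (2 : ℂ) else 1,
    div_ne_zero hc hp, fun x => ?_⟩
  have hg : D.toGSLC.graph = D.graph := rfl
  rw [h, hg, D.graphStateVec_glOp]
  field_simp

end PhasePolyDiagram

/-! ### The canonical diagram -/

namespace PhasePolyDiagram

variable {n : ℕ}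

theorem mem_supp_iff (D : PhasePolyDiagram n) {ψ : (Fin n → ZMod 2) → ℂ} {c : ℂ} (hc : c ≠ 0)
    (h : ∀ x, ψ x = c * D.formVec x) (x : Fin n → ZMod 2) :
    x ∈ supp ψ ↔ ∀ k, D.colour k = Colour.red → D.ParityAt k x := by
  classical
  have h1 : x ∈ supp ψ ↔ c * D.formVec x ≠ 0 := by rw [← h]; rfl
  rw [h1, formVec_eq]
  split_ifs with hp
  · exact iff_of_true (mul_ne_zero hc (iPow_ne_zero _)) hp
  · simp [hp]

open Classical in
/-- The point of the support of a diagram with given values at the green spiders. -/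
noncomputable def extendGreen (D : PhasePolyDiagram n) (v : Fin n → ZMod 2) (k : Fin n) : ZMod 2 :=
  if D.colour k = Colour.green then v k
  else (if D.phase k = 0 then 0 else 1) + ∑ j with D.graph.Adj k j, v j

theorem colour_green_of_adj (D : PhasePolyDiagram n) {k j : Fin n} (hk : D.colour k = Colour.red)
    (h : D.graph.Adj k j) : D.colour j = Colour.green := by
  cases hj : D.colour j with
  | green => rfl
  | red => exact absurd h (D.red_indep k j hk hj)

theorem extendGreen_of_green (D : PhasePolyDiagram n) (v : Fin n → ZMod 2) {k : Fin n}
    (h : D.colour k = Colour.green) : D.extendGreen v k = v k := if_pos h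

theorem parityAt_extendGreen (D : PhasePolyDiagram n) (v : Fin n → ZMod 2) {k : Fin n}
    (h : D.colour k = Colour.red) : D.ParityAt k (D.extendGreen v) := by
  classical
  rw [ParityAt, extendGreen, if_neg (by simp [h])]
  congr 1
  refine Finset.sum_congr rfl fun j hj => ?_
  rw [D.extendGreen_of_green v (D.colour_green_of_adj h (Finset.mem_filter.1 hj).2)]

/-- Values at the green spiders extend uniquely, because red spiders have only green neighbours. -/
theorem isFreeSet_green (D : PhasePolyDiagram n) {A : Set (Fin n → ZMod 2)}
    (hA : ∀ x, x ∈ A ↔ ∀ k, D.colour k = Colour.red → D.ParityAt k x) :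
    IsFreeSet A {j | D.colour j = Colour.green} := by
  classical
  intro v
  refine ⟨D.extendGreen v, ⟨(hA _).2 fun k hk => D.parityAt_extendGreen v hk,
    fun j hj => D.extendGreen_of_green v hj⟩, ?_⟩
  rintro y ⟨hy, hv⟩
  funext k
  cases hc : D.colour k with
  | green => rw [D.extendGreen_of_green v hc]; exact hv k hc
  | red =>
    have hn : ¬ D.colour k = Colour.green := by simp [hc]
    rw [(hA y).1 hy k hc, extendGreen, if_neg hn]
    congr 1
    exact Finset.sum_congr rfl fun j hj =>
      hv j (D.colour_green_of_adj hc (Finset.mem_filter.1 hj).2)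

/-- If every red spider is connected to earlier spiders only, the greedy choice of free variables
selects the green spiders. -/
theorem isCanonicalFree_iff (D : PhasePolyDiagram n) {A : Set (Fin n → ZMod 2)}
    (hA : ∀ x, x ∈ A ↔ ∀ k, D.colour k = Colour.red → D.ParityAt k x)
    (hD : ∀ d f, ¬ D.LaterConnection d f) (j : Fin n) :
    IsCanonicalFree A j ↔ D.colour j = Colour.green := by
  classical
  induction j using WellFoundedLT.induction with
  | ind j ih =>
    rw [IsCanonicalFree]
    cases hc : D.colour j with
    | red =>
      simp only [reduceCtorEq, iff_false, not_not]
      intro x hx y hy hxy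
      rw [(hA x).1 hx j hc, (hA y).1 hy j hc]
      congr 1
      refine Finset.sum_congr rfl fun k hk => ?_
      have ha := (Finset.mem_filter.1 hk).2
      have hg := D.colour_green_of_adj hc ha
      have hlt : k < j := lt_of_le_of_ne
        (not_lt.1 fun h => hD j k ⟨hc, hg, ha, h⟩) (D.graph.ne_of_adj ha).symm
      exact hxy k hlt ((ih k hlt).2 hg)
    | green =>
      simp only [iff_true]
      intro h
      -- Two points of the support that agree at all green spiders except `j`.
      have h1 := h (D.extendGreen 0) ((hA _).2 fun k hk => D.parityAt_extendGreen _ hk)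
        (D.extendGreen (Pi.single j 1)) ((hA _).2 fun k hk => D.parityAt_extendGreen _ hk)
        fun k hk hf => by
          have hg := (ih k hk).1 hf
          rw [D.extendGreen_of_green _ hg, D.extendGreen_of_green _ hg, Pi.single_eq_of_ne hk.ne]
          rfl
      rw [D.extendGreen_of_green _ hc, D.extendGreen_of_green _ hc, Pi.single_eq_same] at h1
      exact zero_ne_one h1

theorem isCanonicalDiagram_of_forall_not_laterConnection (D : PhasePolyDiagram n)
    {ψ : (Fin n → ZMod 2) → ℂ} {c : ℂ} (hc : c ≠ 0) (h : ∀ x, ψ x = c * D.formVec x)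
    (hD : ∀ d f, ¬ D.LaterConnection d f) : IsCanonicalDiagram ψ D := by
  classical
  have hA := D.mem_supp_iff hc h
  have hF : canonicalFreeSet (supp ψ) = {j | D.colour j = Colour.green} :=
    Set.ext fun j => D.isCanonicalFree_iff hA hD j
  rw [IsCanonicalDiagram, hF]
  refine ⟨D.isFreeSet_green hA, fun j => Iff.rfl, fun x hx k hk => (hA x).1 hx k hk, c, hc,
    fun x hx => ?_⟩
  rw [h, formVec_eq, if_pos ((hA x).1 hx)]
  rfl

theorem lcSteps_of_swapSteps {D E : PhasePolyDiagram n}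
    (h : Relation.ReflTransGen SwapStep D E) :
    Relation.ReflTransGen GSLC.LCStep D.toGSLC E.toGSLC := by
  induction h with
  | refl => exact .refl
  | tail _ hs ih => exact ih.trans hs.lcSteps

theorem exists_swapSteps_terminal (D : PhasePolyDiagram n) :
    ∃ E, Relation.ReflTransGen SwapStep D E ∧ ¬ ∃ E', SwapStep E E' := by
  induction hw : D.greenWeight using Nat.strong_induction_on generalizing D with
  | _ m ih =>
    by_cases h : ∃ D', SwapStep D D'
    · obtain ⟨D', hs⟩ := h
      obtain ⟨E, hE, ht⟩ := ih _ (hw ▸ hs.greenWeight_lt) D' rfl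
      exact ⟨E, .head hs hE, ht⟩
    · exact ⟨D, .refl, h⟩

/-- A diagram at which the procedure stops is the canonical diagram of the initial state. -/
theorem isCanonicalDiagram_of_swapSteps {D E : PhasePolyDiagram n}
    (h : Relation.ReflTransGen SwapStep D E) (hE : ¬ ∃ E', SwapStep E E') :
    IsCanonicalDiagram D.interp E := by
  obtain ⟨c, hc, h1⟩ :=
    (D.represents_interp.lcSteps (lcSteps_of_swapSteps h)).eq_smul E.represents_interp
  obtain ⟨c', hc', h2⟩ := E.exists_interp_eq
  refine E.isCanonicalDiagram_of_forall_not_laterConnection (mul_ne_zero hc hc')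
    (fun x => by rw [h1, h2, mul_assoc]) fun d f hdf => hE ?_
  obtain ⟨E', hs⟩ := E.exists_swapAt hdf
  exact ⟨E', d, f, hdf, hs⟩

end PhasePolyDiagram

theorem mainTheorem4 (n : ℕ) (D : PhasePolyDiagram n) :
    (∃ C : PhasePolyDiagram n,
      IsCanonicalDiagram D.interp C ∧ GSLC.Rewrites D.toGSLC C.toGSLC) ∧
    (∀ d f : Fin n, D.LaterConnection d f → ∃ D', PhasePolyDiagram.SwapAt d f D D') ∧
    (¬ ∃ s : ℕ → PhasePolyDiagram n,
      s 0 = D ∧ ∀ t, PhasePolyDiagram.SwapStep (s t) (s (t + 1))) ∧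
    (∀ E : PhasePolyDiagram n, Relation.ReflTransGen PhasePolyDiagram.SwapStep D E →
      (GSLC.Rewrites D.toGSLC E.toGSLC ∧
        ((¬ ∃ E', PhasePolyDiagram.SwapStep E E') → IsCanonicalDiagram D.interp E))) := by
  have hrw (E) (h : Relation.ReflTransGen PhasePolyDiagram.SwapStep D E) :
      GSLC.Rewrites D.toGSLC E.toGSLC :=
    GSLC.rewrites_of_lcSteps (PhasePolyDiagram.lcSteps_of_swapSteps h)
  refine ⟨?_, fun d f => D.exists_swapAt, ?_, fun E h =>
    ⟨hrw E h, PhasePolyDiagram.isCanonicalDiagram_of_swapSteps h⟩⟩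
  · obtain ⟨C, hC, ht⟩ := D.exists_swapSteps_terminal
    exact ⟨C, PhasePolyDiagram.isCanonicalDiagram_of_swapSteps hC ht, hrw C hC⟩
  · rintro ⟨s, -, hs⟩
    exact not_strictAnti_of_wellFoundedLT (fun t => (s t).greenWeight)
      (strictAnti_nat_of_succ_lt fun t => (hs t).greenWeight_lt)
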